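/- Let $\ell\in\mathbb Z_{\ge 0}$, $\mathbf b\in\mathbb C\setminus\{0\}$, $\mathbf c\in\mathbb R$, $\lambda>0$, $\theta\in\mathbb C$, and put $s=|\mathbf b|^{2/(\ell+2)}$. Let $\mathbb C_+=\{z\in\mathbb C:\operatorname{Re}z>0\}$. Let $A^2_\ell$ be the weighted Bergman space of holomorphic functions $h:\mathbb C_+\to\mathbb C$ with $$\|h\|^2=\frac1\pi\int_{-\infty}^{\infty}\int_0^\infty x^\ell|h(x+iy)|^2\,dx\,dy<\infty,$$ and let $L^2_\ell$ be the Lebesgue space of measurable functions $\mathbf h:(0,\infty)\to\mathbb C$ (up to a.e. equality) with $$\|\mathbf h\|^2=\int_0^\infty|\mathbf h(t)|^2\,\frac{\Gamma(1+\ell)}{2^\ell t^{1+\ell}}\,dt<\infty.$$ The Laplace transform $\mathcal L\mathbf h(z)=\int_0^\infty \mathbf h(t)e^{-zt}\,dt$ is an isometric isomorphism of $L^2_\ell$ onto $A^2_\ell$, the operator $U_{\mathbf b,\mathbf c}\xi(z)=\mathbf b\,\xi(sz+i\mathbf c)$ is unitary on $A^2_\ell$, and $\mathcal C_\star\xi(z)=z^{-(\ell+2)}\,\overline{\xi(1/\overline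 z)}$ is a conjugation (antilinear isometric involution) on $A^2_\ell$. For functions $f,g$ write $E_{f,g}h=f\cdot(h\circ g)$. The maximal weighted composition operator $W_{f,g,\max}$ on one of these spaces has as its domain all $h$ in the space with $E_{f,g}h$ in the space, and $W_{f,g,\max}h=E_{f,g}h$. Let $$g(w)=\lambda\left(w+i\mathbf c s^{-1}\right)-i\mathbf c s^{-1},\qquad f(w)=\theta\qquad(w\in\mathbb C_+),$$ $$\varphi(t)=\frac t\lambda,\qquad \psi(t)=\frac{\theta}{\lambda}\,\exp\!\left(-\frac{t\,i\mathbf c\,s^{-1}(\lambda-1)}{\lambda}\right)\qquad(t>0).$$ Then: 1. $\mathcal L^{-1}E_{f,g}\mathcal L=E_{\psi,\varphi}$ on $L^2_\ell$; that is, for every $\mathbf h\in L^2_\ell$ the function $E_{f,g}\mathcal L\mathbf h$ belongs to $A^2_\ell$ and $\mathcal L^{-1}E_{f,g}\mathcal L\mathbf h=E_{\psi,\varphi}\mathbf h$. 2. $W_{\psi,\varphi,\max}=\mathcal L^{-1}W_{f,g,\max}\mathcal L$ (domains included), and this densely defined operator on $L^2_\ell$ is complex symmetric with respect to $J=\mathcal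 L^{-1}U_{\mathbf b,\mathbf c}\,\mathcal C_\star\, U_{\mathbf b,\mathbf c}^*\mathcal L$: $J$ is a conjugation on $L^2_\ell$ and $W_{\psi,\varphi,\max}=J\,W_{\psi,\varphi,\max}^*\,J$. -/

import Mathlib

open MeasureTheory Set ComplexConjugate

namespace BergmanLebesgue

noncomputable section

/-- The open right half-plane. -/
def rhp : Set ℂ := {z | 0 < z.re}

theorem isOpen_rhp : IsOpen rhp := isOpen_lt continuous_const Complex.continuous_re

theorem measurableSet_rhp : MeasurableSet rhp := isOpen_rhp.measurableSet

/-- The weighted area measure `(1/π) x^ℓ dx dy` on the right half-plane (zero outside). -/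
def bergmanMeasure (ℓ : ℕ) : Measure ℂ :=
  (volume.restrict rhp).withDensity fun z => ENNReal.ofReal (z.re ^ ℓ / Real.pi)

theorem eqOn_of_ae_eq {ℓ : ℕ} {F G : ℂ → ℂ} (hF : DifferentiableOn ℂ F rhp)
    (hG : DifferentiableOn ℂ G rhp) (h : F =ᵐ[bergmanMeasure ℓ] G) : EqOn F G rhp := by
  refine Measure.eqOn_open_of_ae_eq (μ := volume) ?_ isOpen_rhp hF.continuousOn hG.continuousOn
  have hm : Measurable fun z : ℂ => ENNReal.ofReal (z.re ^ ℓ / Real.pi) := by fun_prop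
  have h1 := (ae_withDensity_iff hm).1 h
  filter_upwards [h1, ae_restrict_mem measurableSet_rhp] with z hz hzr
  apply hz
  have : 0 < z.re ^ ℓ / Real.pi := div_pos (pow_pos hzr ℓ) Real.pi_pos
  simpa using this

/-- The weighted Bergman space of the right half-plane: the square integrable (classes of)
functions that have a holomorphic representative. It carries the norm
`(1/π) ∫∫ x^ℓ |h(x+iy)|² dx dy` (squared) and the corresponding inner product. The holomorphic
function on `rhp` which an element stands for is `bval`. -/
def BergmanSpace (ℓ : ℕ) : Submodule ℂ (Lp ℂ 2 (bergmanMeasure ℓ)) where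
  carrier := {h | ∃ F : ℂ → ℂ, DifferentiableOn ℂ F rhp ∧ h =ᵐ[bergmanMeasure ℓ] F}
  add_mem' := by
    rintro h k ⟨F, hF, hFe⟩ ⟨G, hG, hGe⟩
    exact ⟨F + G, hF.add hG, (Lp.coeFn_add h k).trans (hFe.add hGe)⟩
  zero_mem' := ⟨0, differentiableOn_const 0, Lp.coeFn_zero _ _ _⟩
  smul_mem' := by
    rintro a h ⟨F, hF, hFe⟩
    exact ⟨a • F, hF.const_smul a, (Lp.coeFn_smul a h).trans (hFe.const_smul a)⟩

/-- The value at `z ∈ rhp` of the holomorphic function `h` (and `0` for `z ∉ rhp`). -/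
def bval {ℓ : ℕ} (h : BergmanSpace ℓ) : ℂ → ℂ := rhp.indicator (Classical.choose h.2)

theorem bval_differentiableOn {ℓ : ℕ} (h : BergmanSpace ℓ) : DifferentiableOn ℂ (bval h) rhp :=
  (Classical.choose_spec h.2).1.congr fun _ hz => indicator_of_mem hz _

theorem ae_mem_rhp (ℓ : ℕ) : ∀ᵐ z ∂(bergmanMeasure ℓ), z ∈ rhp :=
  (withDensity_absolutelyContinuous _ _).ae_le (ae_restrict_mem measurableSet_rhp)

theorem bval_ae_eq {ℓ : ℕ} (h : BergmanSpace ℓ) :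
    (h : Lp ℂ 2 (bergmanMeasure ℓ)) =ᵐ[bergmanMeasure ℓ] bval h := by
  filter_upwards [(Classical.choose_spec h.2).2, ae_mem_rhp ℓ] with z hz hzr
  rw [hz, bval, indicator_of_mem hzr]

theorem bval_eqOn {ℓ : ℕ} (h : BergmanSpace ℓ) {F : ℂ → ℂ} (hF : DifferentiableOn ℂ F rhp)
    (hh : (h : Lp ℂ 2 (bergmanMeasure ℓ)) =ᵐ[bergmanMeasure ℓ] F) : EqOn (bval h) F rhp :=
  eqOn_of_ae_eq (bval_differentiableOn h) hF ((bval_ae_eq h).symm.trans hh)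

theorem bergman_ext {ℓ : ℕ} {h k : BergmanSpace ℓ} (H : EqOn (bval h) (bval k) rhp) : h = k := by
  apply Subtype.ext
  apply Lp.ext
  filter_upwards [bval_ae_eq h, bval_ae_eq k, ae_mem_rhp ℓ] with z h1 h2 hz
  rw [h1, h2, H hz]

theorem bval_add {ℓ : ℕ} (h k : BergmanSpace ℓ) (z : ℂ) : bval (h + k) z = bval h z + bval k z := by
  by_cases hz : z ∈ rhp
  · refine bval_eqOn (h + k) (F := bval h + bval k)
      ((bval_differentiableOn h).add (bval_differentiableOn k)) ?_ hz
    exact (Lp.coeFn_add _ _).trans ((bval_ae_eq h).add (bval_ae_eq k))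
  · simp [bval, hz]

theorem bval_smul {ℓ : ℕ} (a : ℂ) (h : BergmanSpace ℓ) (z : ℂ) :
    bval (a • h) z = a * bval h z := by
  by_cases hz : z ∈ rhp
  · refine bval_eqOn (a • h) (F := a • bval h) ((bval_differentiableOn h).const_smul a) ?_ hz
    exact (Lp.coeFn_smul _ _).trans ((bval_ae_eq h).const_smul a)
  · simp [bval, hz]

theorem bval_zero {ℓ : ℕ} (z : ℂ) : bval (0 : BergmanSpace ℓ) z = 0 := by
  simpa using bval_smul (0 : ℂ) (0 : BergmanSpace ℓ) z

/-- The measure `Γ(1+ℓ) / (2^ℓ t^(1+ℓ)) dt` on `(0,∞)` (zero outside). -/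
def lebesgueMeasure (ℓ : ℕ) : Measure ℝ :=
  (volume.restrict (Ioi 0)).withDensity fun t =>
    ENNReal.ofReal (Real.Gamma (1 + ℓ) / (2 ^ ℓ * t ^ (1 + ℓ)))

/-- The Lebesgue space of measurable functions `h` on `(0,∞)` with
`∫ |h(t)|² Γ(1+ℓ) / (2^ℓ t^(1+ℓ)) dt < ∞`. -/
abbrev LebesgueSpace (ℓ : ℕ) : Type := Lp ℂ 2 (lebesgueMeasure ℓ)

/-- The integrand `t ↦ h(t) e^{-zt}` of the Laplace transform. -/
def laplaceIntegrand (h : ℝ → ℂ) (z : ℂ) (t : ℝ) : ℂ := h t * Complex.exp (-(z * t))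

/-- The Laplace transform `∫₀^∞ h(t) e^{-zt} dt`. -/
def laplace (h : ℝ → ℂ) (z : ℂ) : ℂ := ∫ t in Ioi (0 : ℝ), laplaceIntegrand h z t

/-- The weighted composition expression `E_{f,g} h = f · (h ∘ g)`. -/
def wcomp {X : Type*} (f : X → ℂ) (g : X → X) (h : X → ℂ) : X → ℂ := fun x => f x * h (g x)

/-- The maximal domain on the Bergman space: all `h` for which `E_{f,g} h` belongs to it. -/
def bergmanDom (ℓ : ℕ) (f g : ℂ → ℂ) : Submodule ℂ (BergmanSpace ℓ) where
  carrier := {h | ∃ k : BergmanSpace ℓ, EqOn (bval k) (wcomp f g (bval h)) rhp}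
  add_mem' := by
    rintro h₁ h₂ ⟨k₁, e₁⟩ ⟨k₂, e₂⟩
    refine ⟨k₁ + k₂, fun z hz => ?_⟩
    rw [bval_add, e₁ hz, e₂ hz]
    simp only [wcomp, bval_add]
    ring
  zero_mem' := ⟨0, fun z _ => by simp [wcomp, bval_zero]⟩
  smul_mem' := by
    rintro a h ⟨k, e⟩
    refine ⟨a • k, fun z hz => ?_⟩
    rw [bval_smul, e hz]
    simp only [wcomp, bval_smul]
    ring

/-- The element `E_{f,g} h` of the Bergman space, for `h` in the maximal domain. -/
def bergmanImage {ℓ : ℕ} {f g : ℂ → ℂ} (h : bergmanDom ℓ f g) : BergmanSpace ℓ :=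
  Classical.choose (show ∃ k : BergmanSpace ℓ, EqOn (bval k) (wcomp f g (bval h.1)) rhp from h.2)

theorem bergmanImage_eqOn {ℓ : ℕ} {f g : ℂ → ℂ} (h : bergmanDom ℓ f g) :
    EqOn (bval (bergmanImage h)) (wcomp f g (bval h.1)) rhp :=
  Classical.choose_spec
    (show ∃ k : BergmanSpace ℓ, EqOn (bval k) (wcomp f g (bval h.1)) rhp from h.2)

/-- The maximal weighted composition operator on the Bergman space: its domain consists of all `h`
for which `E_{f,g} h` belongs to the Bergman space, and it sends such an `h` to `E_{f,g} h`. -/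
def bergmanWCompMax (ℓ : ℕ) (f g : ℂ → ℂ) : BergmanSpace ℓ →ₗ.[ℂ] BergmanSpace ℓ where
  domain := bergmanDom ℓ f g
  toFun :=
    { toFun := bergmanImage
      map_add' := fun h₁ h₂ => by
        apply bergman_ext
        intro z hz
        rw [bval_add, bergmanImage_eqOn _ hz, bergmanImage_eqOn _ hz, bergmanImage_eqOn _ hz]
        simp only [wcomp, Submodule.coe_add, bval_add]
        ring
      map_smul' := fun a h => by
        apply bergman_ext
        intro z hz
        rw [RingHom.id_apply, bval_smul, bergmanImage_eqOn _ hz, bergmanImage_eqOn _ hz]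
        simp only [wcomp, Submodule.coe_smul, bval_smul]
        ring }

/-- The maximal weighted composition operator on the Lebesgue space: its domain consists of all
`h` for which `E_{ψ,φ} h` belongs to the Lebesgue space, and it sends such an `h` to `E_{ψ,φ} h`.
The hypothesis on `φ` makes `E_{ψ,φ}` well defined on classes of functions. -/
def lebesgueWCompMax (ℓ : ℕ) (ψ : ℝ → ℂ) (φ : ℝ → ℝ)
    (hφ : Measure.QuasiMeasurePreserving φ (lebesgueMeasure ℓ) (lebesgueMeasure ℓ)) :
    LebesgueSpace ℓ →ₗ.[ℂ] LebesgueSpace ℓ :=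
  have hadd : ∀ h k : LebesgueSpace ℓ,
      wcomp ψ φ (h + k : LebesgueSpace ℓ) =ᵐ[lebesgueMeasure ℓ] wcomp ψ φ h + wcomp ψ φ k := by
    intro h k
    filter_upwards [hφ.ae (Lp.coeFn_add h k)] with t ht
    simp only [wcomp, ht, Pi.add_apply]
    ring
  have hsmul : ∀ (a : ℂ) (h : LebesgueSpace ℓ),
      wcomp ψ φ (a • h : LebesgueSpace ℓ) =ᵐ[lebesgueMeasure ℓ] a • wcomp ψ φ h := by
    intro a h
    filter_upwards [hφ.ae (Lp.coeFn_smul a h)] with t ht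
    simp only [wcomp, ht, Pi.smul_apply, smul_eq_mul]
    ring
  { domain :=
      { carrier := {h | MemLp (wcomp ψ φ h) 2 (lebesgueMeasure ℓ)}
        add_mem' := fun {h k} h₁ h₂ => (memLp_congr_ae (hadd h k)).2 (h₁.add h₂)
        zero_mem' := by
          have h0 := hsmul 0 0
          rw [zero_smul, zero_smul] at h0
          exact (memLp_congr_ae h0).2 MemLp.zero
        smul_mem' := fun a h h₁ => (memLp_congr_ae (hsmul a h)).2 (h₁.const_smul a) }
    toFun :=
      { toFun := fun h => MemLp.toLp (wcomp ψ φ (h : LebesgueSpace ℓ)) h.2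
        map_add' := fun h k => by
          rw [← MemLp.toLp_add]
          exact MemLp.toLp_congr _ _ (hadd h k)
        map_smul' := fun a h => by
          rw [RingHom.id_apply, ← MemLp.toLp_const_smul]
          exact MemLp.toLp_congr _ _ (hsmul a h) } }

/-- The dilation `t ↦ t / lam` preserves null sets of `(0,∞)`. -/
theorem quasiMeasurePreserving_div (ℓ : ℕ) {lam : ℝ} (hlam : 0 < lam) :
    Measure.QuasiMeasurePreserving (fun t : ℝ => t / lam)
      (lebesgueMeasure ℓ) (lebesgueMeasure ℓ) := by
  have hm : Measurable fun t : ℝ =>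
      ENNReal.ofReal (Real.Gamma (1 + ℓ) / (2 ^ ℓ * t ^ (1 + ℓ))) := by fun_prop
  have hpos : ∀ t : ℝ, 0 < t → 0 < Real.Gamma (1 + ℓ) / (2 ^ ℓ * t ^ (1 + ℓ)) := fun t ht =>
    div_pos (Real.Gamma_pos_of_pos (by positivity)) (by positivity)
  refine ⟨by fun_prop, Measure.AbsolutelyContinuous.mk fun s hs h0 => ?_⟩
  rw [Measure.map_apply (by fun_prop) hs]
  have key : ∀ u : Set ℝ, MeasurableSet u →
      (lebesgueMeasure ℓ u = 0 ↔ volume (u ∩ Ioi 0) = 0) := by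
    intro u hu
    rw [lebesgueMeasure, withDensity_apply_eq_zero hm, Measure.restrict_apply'
      measurableSet_Ioi]
    have : {x : ℝ | ENNReal.ofReal (Real.Gamma (1 + ℓ) / (2 ^ ℓ * x ^ (1 + ℓ))) ≠ 0} ∩ u ∩ Ioi 0
        = u ∩ Ioi 0 := by
      ext x
      constructor
      · rintro ⟨⟨_, h2⟩, h3⟩
        exact ⟨h2, h3⟩
      · rintro ⟨h2, h3⟩
        refine ⟨⟨?_, h2⟩, h3⟩
        have := hpos x h3
        simpa using this
    rw [this]
  have hpre : MeasurableSet ((fun t : ℝ => t / lam) ⁻¹' s) := hs.preimage (by fun_prop)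
  rw [key _ hpre]
  rw [key _ hs] at h0
  have : (fun t : ℝ => t / lam) ⁻¹' s ∩ Ioi 0 = (fun t : ℝ => lam⁻¹ * t) ⁻¹' (s ∩ Ioi 0) := by
    ext t
    simp only [mem_inter_iff, mem_preimage, mem_Ioi]
    rw [div_eq_inv_mul]
    have : 0 < lam⁻¹ * t ↔ 0 < t := mul_pos_iff_of_pos_left (inv_pos.2 hlam)
    rw [this]
  rw [this, Real.volume_preimage_mul_left (inv_ne_zero hlam.ne'), h0, mul_zero]

section Operators

variable {E F : Type*} [NormedAddCommGroup E] [InnerProductSpace ℂ E]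
  [NormedAddCommGroup F] [InnerProductSpace ℂ F]

/-- A conjugation: an antilinear isometric involution. -/
def IsConjugation (C : E →ₗ⋆[ℂ] E) : Prop :=
  (∀ x, ‖C x‖ = ‖x‖) ∧ ∀ x, C (C x) = x

/-- The antilinear map `V⁻¹ C V`. -/
def transportConj (V : E ≃ₗᵢ[ℂ] F) (C : F →ₗ⋆[ℂ] F) : E →ₗ⋆[ℂ] E where
  toFun x := V.symm (C (V x))
  map_add' x y := by simp
  map_smul' a x := by simp

/-- The (unbounded) operator `V⁻¹ T V`, with domain `{x | V x ∈ dom T}`. -/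
def transportOp (V : E ≃ₗᵢ[ℂ] F) (T : F →ₗ.[ℂ] F) : E →ₗ.[ℂ] E where
  domain := T.domain.comap V.toLinearEquiv.toLinearMap
  toFun :=
    { toFun := fun x => V.symm (T ⟨V x, x.2⟩)
      map_add' := fun x y => by
        rw [← map_add, ← T.map_add]
        congr 2
        exact Subtype.ext (map_add V (x : E) y)
      map_smul' := fun a x => by
        rw [RingHom.id_apply, ← map_smul, ← T.map_smul]
        congr 2
        exact Subtype.ext (map_smul V a (x : E)) }

/-- The (unbounded) operator `C T C` for an antilinear `C`, with domain `{x | C x ∈ dom T}`. -/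
def conjOp (C : E →ₗ⋆[ℂ] E) (T : E →ₗ.[ℂ] E) : E →ₗ.[ℂ] E where
  domain := T.domain.comap C
  toFun :=
    { toFun := fun x => C (T ⟨C x, x.2⟩)
      map_add' := fun x y => by
        rw [← map_add, ← T.map_add]
        congr 2
        exact Subtype.ext (map_add C (x : E) y)
      map_smul' := fun a x => by
        have h : (⟨C (a • x : E), (a • x).2⟩ : T.domain) = conj a • ⟨C x, x.2⟩ :=
          Subtype.ext (LinearMap.map_smulₛₗ C a (x : E))
        rw [RingHom.id_apply]
        change C (T ⟨C (a • x : E), (a • x).2⟩) = _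
        rw [h, T.map_smul, LinearMap.map_smulₛₗ]
        simp }

/-- A densely defined operator `B` is complex symmetric with respect to the conjugation `C`
(`C`-selfadjoint) if `B = C B* C`, domains included. -/
def IsCSelfAdjoint [CompleteSpace E] (C : E →ₗ⋆[ℂ] E) (B : E →ₗ.[ℂ] E) : Prop :=
  IsConjugation C ∧ Dense (B.domain : Set E) ∧ B = conjOp C B.adjoint

end Operators

end

end BergmanLebesgue

open BergmanLebesgue

/-! The map `g` is `w ↦ lam * w + i a` with `a = c (lam - 1) / s` real. Substituting `t = lam * u`
in the Laplace integral turns `ψ(t) h(t / lam)` into `θ · (𝓛h)(lam * z + i a)`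
(`laplace_wcomp_dilation`). Since `|ψ|` is constant and the weight is homogeneous, `E_{ψ,φ}` maps
the whole Lebesgue space to itself (`memLp_wcomp_dilation`). Hence both maximal operators are
everywhere defined, and no domain question remains.

For complex symmetry, conjugating by `U*` moves the centre of the dilation to `0` and gives `(θ / β)
D`, where `D ξ(z) = β ξ(lam * z)` is unitary for `β² = lam ^ (ℓ + 2)`. The conjugation `C_⋆` inverts
dilations, `C D C = D⁻¹ = D*`, and its antilinearity conjugates the scalar, so `C_⋆` sends `(θ / β)
D` to its adjoint (`inversion_dilation_inversion`, `inner_weighted_composition`).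

The three background operators are also constructed. The Laplace transform is isometric by
Plancherel on each vertical line and Tonelli (`lintegral_laplace_sq`). It is onto because its closed
range contains a multiple of the reproducing kernel at `1` and the images of that function under the
affine unitaries `U*`; an element orthogonal to all of these vanishes at every point
(`exists_laplace_unitary`). -/

namespace BergmanLebesgue

/-! ### Plancherel's theorem for the integral Fourier transform. -/

section Plancherel

open FourierTransform SchwartzMap

/-- Tested against a smooth compactly supported function, both transforms can be moved onto the test
function: the `L²` one through tempered distributions, the integral one by Fubini. -/
theorem fourier_toLp_ae_eq {f : ℝ → ℂ} (h1 : Integrable f) (h2 : MemLp f 2 volume) :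
    (𝓕 (h2.toLp f) : Lp ℂ 2 (volume : Measure ℝ)) =ᵐ[volume] 𝓕 f := by
  have hloc : LocallyIntegrable (𝓕 (h2.toLp f) : Lp ℂ 2 (volume : Measure ℝ)) volume :=
    (Lp.memLp _).locallyIntegrable (by norm_num)
  have hcont : Continuous (𝓕 f) :=
    VectorFourier.fourierIntegral_continuous Real.continuous_fourierChar
      (by exact continuous_inner) h1
  refine ae_eq_of_integral_contDiff_smul_eq hloc hcont.locallyIntegrable fun g hg hgc => ?_
  have hgc' : HasCompactSupport fun x => (g x : ℂ) :=
    hgc.comp_left (g := fun x : ℝ => (x : ℂ)) (by simp)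
  have hgd : ContDiff ℝ (⊤ : ℕ∞) fun x => (g x : ℂ) := Complex.ofRealCLM.contDiff.comp hg
  let G : 𝓢(ℝ, ℂ) := hgc'.toSchwartzMap hgd
  have hG : ∀ x, G x = g x := fun x => rfl
  have e1 := congrArg (fun T => T G) (Lp.fourier_toTemperedDistribution_eq (h2.toLp f))
  simp only [TemperedDistribution.fourier_apply, Lp.toTemperedDistribution_apply, hG] at e1
  have e2 : ∫ x, (𝓕 G) x • (h2.toLp f) x = ∫ x, f x • (𝓕 (G : ℝ → ℂ)) x := by
    refine integral_congr_ae ?_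
    filter_upwards [h2.coeFn_toLp] with x hx
    rw [hx, SchwartzMap.fourier_coe, smul_eq_mul, smul_eq_mul, mul_comm]
  have e3 : ∫ x, 𝓕 f x • G x = ∫ x, f x • 𝓕 (G : ℝ → ℂ) x := by
    have := VectorFourier.integral_fourierIntegral_smul_eq_flip (L := innerₗ ℝ)
      Real.continuous_fourierChar continuous_inner h1 (G.integrable (μ := volume))
    rwa [flip_innerₗ] at this
  simp only [← Complex.coe_smul]
  rw [← e1, e2, ← e3]
  refine integral_congr_ae (Filter.Eventually.of_forall fun x => ?_)
  simp only [smul_eq_mul, hG, mul_comm]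

theorem eLpNorm_fourier_eq {f : ℝ → ℂ} (h1 : Integrable f) (h2 : MemLp f 2 volume) :
    eLpNorm (𝓕 f) 2 volume = eLpNorm f 2 volume := by
  rw [← eLpNorm_congr_ae (fourier_toLp_ae_eq h1 h2), ← eLpNorm_congr_ae h2.coeFn_toLp]
  have := Lp.norm_fourier_eq (h2.toLp f)
  rwa [Lp.norm_def, Lp.norm_def, ENNReal.toReal_eq_toReal_iff' (Lp.eLpNorm_ne_top _)
    (Lp.eLpNorm_ne_top _)] at this

theorem eLpNorm_two_sq {α : Type*} [MeasurableSpace α] (μ : Measure α) (f : α → ℂ) :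
    eLpNorm f 2 μ ^ 2 = ∫⁻ x, ‖f x‖ₑ ^ 2 ∂μ := by
  have := eLpNorm_nnreal_pow_eq_lintegral (f := f) (μ := μ) (p := 2) two_ne_zero
  simpa using this

theorem lintegral_fourier_sq {f : ℝ → ℂ} (h1 : Integrable f) (h2 : MemLp f 2 volume) :
    ∫⁻ y, ‖𝓕 f y‖ₑ ^ 2 = ∫⁻ t, ‖f t‖ₑ ^ 2 := by
  rw [← eLpNorm_two_sq, ← eLpNorm_two_sq, eLpNorm_fourier_eq h1 h2]

end Plancherel

/-! ### Holomorphic changes of variables in the plane. -/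

section ChangeOfVariables

theorem hasFDerivWithinAt_real_of_hasDerivAt {f : ℂ → ℂ} {a : ℂ} {S : Set ℂ} {z : ℂ}
    (h : HasDerivAt f a z) :
    HasFDerivWithinAt f ((ContinuousLinearMap.toSpanSingleton ℂ a).restrictScalars ℝ) S z :=
  (h.hasFDerivAt.restrictScalars ℝ).hasFDerivWithinAt

theorem abs_det_toSpanSingleton (a : ℂ) :
    |((ContinuousLinearMap.toSpanSingleton ℂ a).restrictScalars ℝ).det| = ‖a‖ ^ 2 := by
  simp [ContinuousLinearMap.det, LinearMap.det_restrictScalars,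
      Algebra.norm_complex_eq, Complex.normSq_eq_norm_sq]

theorem lintegral_image_holomorphic {S : Set ℂ} (hS : MeasurableSet S) {f f' : ℂ → ℂ}
    (hf : ∀ z ∈ S, HasDerivAt f (f' z) z) (hinj : InjOn f S) (G : ℂ → ENNReal) :
    ∫⁻ w in f '' S, G w = ∫⁻ z in S, ENNReal.ofReal (‖f' z‖ ^ 2) * G (f z) := by
  rw [lintegral_image_eq_lintegral_abs_det_fderiv_mul volume hS
    (fun z hz => hasFDerivWithinAt_real_of_hasDerivAt (hf z hz)) hinj]
  simp only [abs_det_toSpanSingleton]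

theorem integral_image_holomorphic {S : Set ℂ} (hS : MeasurableSet S) {f f' : ℂ → ℂ}
    (hf : ∀ z ∈ S, HasDerivAt f (f' z) z) (hinj : InjOn f S) (G : ℂ → ℂ) :
    ∫ w in f '' S, G w = ∫ z in S, ((‖f' z‖ ^ 2 : ℝ) : ℂ) * G (f z) := by
  rw [integral_image_eq_integral_abs_det_fderiv_smul volume hS
    (fun z hz => hasFDerivWithinAt_real_of_hasDerivAt (hf z hz)) hinj]
  simp only [abs_det_toSpanSingleton, Complex.real_smul]

theorem integrableOn_image_holomorphic {S : Set ℂ} (hS : MeasurableSet S) {f f' : ℂ → ℂ}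
    (hf : ∀ z ∈ S, HasDerivAt f (f' z) z) (hinj : InjOn f S) (G : ℂ → ℂ) :
    IntegrableOn G (f '' S) ↔
      IntegrableOn (fun z => ((‖f' z‖ ^ 2 : ℝ) : ℂ) * G (f z)) S := by
  rw [integrableOn_image_iff_integrableOn_abs_det_fderiv_smul volume hS
    (fun z hz => hasFDerivWithinAt_real_of_hasDerivAt (hf z hz)) hinj]
  simp only [abs_det_toSpanSingleton, Complex.real_smul]

end ChangeOfVariables

/-! ### Norms and isometries in the Bergman space. -/

section BergmanBasics

variable {ℓ : ℕ}

theorem lintegral_bergmanMeasure (G : ℂ → ENNReal) :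
    ∫⁻ z, G z ∂(bergmanMeasure ℓ) =
      ∫⁻ z in rhp, ENNReal.ofReal (z.re ^ ℓ / Real.pi) * G z := by
  rw [bergmanMeasure, lintegral_withDensity_eq_lintegral_mul_non_measurable _ (by fun_prop)
    (by simp)]
  rfl

theorem aestronglyMeasurable_bergman {F : ℂ → ℂ} (hF : DifferentiableOn ℂ F rhp) :
    AEStronglyMeasurable F (bergmanMeasure ℓ) :=
  (hF.continuousOn.aestronglyMeasurable measurableSet_rhp).mono_ac
    (withDensity_absolutelyContinuous _ _)

theorem memLp_two_iff_lintegral {α : Type*} [MeasurableSpace α] {μ : Measure α} {f : α → ℂ}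
    (hf : AEStronglyMeasurable f μ) : MemLp f 2 μ ↔ ∫⁻ x, ‖f x‖ₑ ^ 2 ∂μ ≠ ⊤ := by
  rw [← eLpNorm_two_sq, MemLp, lt_top_iff_ne_top]
  simp [hf]

theorem exists_bergman {F : ℂ → ℂ} (hF : DifferentiableOn ℂ F rhp)
    (hfin : ∫⁻ z, ‖F z‖ₑ ^ 2 ∂(bergmanMeasure ℓ) ≠ ⊤) :
    ∃ k : BergmanSpace ℓ, EqOn (bval k) F rhp := by
  have hm := (memLp_two_iff_lintegral (aestronglyMeasurable_bergman hF)).2 hfin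
  exact ⟨⟨hm.toLp F, F, hF, hm.coeFn_toLp⟩, bval_eqOn _ hF hm.coeFn_toLp⟩

theorem Lp_enorm_sq {α : Type*} [MeasurableSpace α] {μ : Measure α} (h : Lp ℂ 2 μ) :
    ‖h‖ₑ ^ 2 = ∫⁻ x, ‖h x‖ₑ ^ 2 ∂μ := by
  rw [Lp.enorm_def, eLpNorm_two_sq]

theorem bergman_enorm_sq (h : BergmanSpace ℓ) :
    ‖h‖ₑ ^ 2 = ∫⁻ z, ‖bval h z‖ₑ ^ 2 ∂(bergmanMeasure ℓ) := by
  rw [show ‖h‖ₑ = ‖(h : Lp ℂ 2 (bergmanMeasure ℓ))‖ₑ from rfl, Lp_enorm_sq]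
  refine lintegral_congr_ae ?_
  filter_upwards [bval_ae_eq h] with z hz
  rw [hz]

theorem norm_eq_of_enorm_sq_eq {V W : Type*} [NormedAddCommGroup V] [NormedAddCommGroup W]
    {x : V} {y : W} (h : ‖x‖ₑ ^ 2 = ‖y‖ₑ ^ 2) : ‖x‖ = ‖y‖ := by
  have := congrArg ENNReal.toReal h
  simp only [ENNReal.toReal_pow, toReal_enorm] at this
  exact (pow_left_inj₀ (norm_nonneg _) (norm_nonneg _) two_ne_zero).1 this

/-- A (semi)linear family of holomorphic functions with the right norms gives an isometry into the
Bergman space. -/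
theorem exists_isometry_to_bergman {σ : ℂ →+* ℂ} {V : Type*} [NormedAddCommGroup V] [Module ℂ V]
    (T : V → ℂ → ℂ) (hd : ∀ x, DifferentiableOn ℂ (T x) rhp)
    (hadd : ∀ x y, ∀ z ∈ rhp, T (x + y) z = T x z + T y z)
    (hsmul : ∀ (a : ℂ) x, ∀ z ∈ rhp, T (a • x) z = σ a * T x z)
    (hnorm : ∀ x, ∫⁻ z, ‖T x z‖ₑ ^ 2 ∂(bergmanMeasure ℓ) = ‖x‖ₑ ^ 2) :
    ∃ U : V →ₛₗᵢ[σ] BergmanSpace ℓ, ∀ x, EqOn (bval (U x)) (T x) rhp := by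
  have hex : ∀ x, ∃ k : BergmanSpace ℓ, EqOn (bval k) (T x) rhp := fun x =>
    exists_bergman (hd x) (by rw [hnorm]; simp)
  choose k hk using hex
  refine ⟨⟨⟨⟨k, fun x y => ?_⟩, fun a x => ?_⟩, fun x => ?_⟩, hk⟩
  · refine bergman_ext fun z hz => ?_
    rw [bval_add, hk _ hz, hk _ hz, hk _ hz, hadd _ _ _ hz]
  · refine bergman_ext fun z hz => ?_
    rw [bval_smul, hk _ hz, hk _ hz, hsmul _ _ _ hz]
  · refine norm_eq_of_enorm_sq_eq ?_
    change ‖k x‖ₑ ^ 2 = _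
    rw [bergman_enorm_sq, ← hnorm x]
    refine lintegral_congr_ae ?_
    filter_upwards [ae_mem_rhp ℓ] with z hz
    rw [hk x hz]

end BergmanBasics

/-! ### The unitary operators induced by affine maps of the half-plane. -/

section AffineOperators

variable {ℓ : ℕ}

theorem affine_mem_rhp {s c : ℝ} (hs : 0 < s) {z : ℂ} (hz : z ∈ rhp) :
    (s * z + Complex.I * c : ℂ) ∈ rhp := by
  have : 0 < z.re := hz
  simp only [rhp, mem_ofPred_eq]
  simp
  positivity

theorem affine_inv_mem_rhp {s c : ℝ} (hs : 0 < s) {z : ℂ} (hz : z ∈ rhp) :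
    ((z - Complex.I * c) / s : ℂ) ∈ rhp := by
  have h := affine_mem_rhp (s := s⁻¹) (c := -(c / s)) (inv_pos.2 hs) hz
  convert h using 1
  push_cast
  ring

theorem affine_affine_inv {s : ℝ} (c : ℝ) (hs : 0 < s) (z : ℂ) :
    (s * ((z - Complex.I * c) / s) + Complex.I * c : ℂ) = z := by
  have : (s : ℂ) ≠ 0 := Complex.ofReal_ne_zero.2 hs.ne'
  field_simp
  ring

theorem image_affine_rhp {s : ℝ} (c : ℝ) (hs : 0 < s) :
    (fun z : ℂ => s * z + Complex.I * c) '' rhp = rhp := by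
  refine Subset.antisymm (image_subset_iff.2 fun z hz => affine_mem_rhp hs hz) fun z hz => ?_
  exact ⟨_, affine_inv_mem_rhp hs hz, affine_affine_inv c hs z⟩

/-- The real Jacobian contributes `s ^ 2` and the weight `s ^ ℓ`, which together are exactly `‖b‖ ^
2`. -/
theorem lintegral_affine {b : ℂ} {s : ℝ} (c : ℝ) (hs : 0 < s) (hbs : ‖b‖ ^ 2 = s ^ (ℓ + 2))
    (F : ℂ → ℂ) :
    ∫⁻ z, ‖b * F (s * z + Complex.I * c)‖ₑ ^ 2 ∂(bergmanMeasure ℓ) =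
      ∫⁻ z, ‖F z‖ₑ ^ 2 ∂(bergmanMeasure ℓ) := by
  have hd : ∀ z ∈ rhp, HasDerivAt (fun z : ℂ => s * z + Complex.I * c) (s : ℂ) z := by
    intro z _
    simpa using ((hasDerivAt_id z).const_mul (s : ℂ)).add_const (Complex.I * c)
  have hinj : InjOn (fun z : ℂ => s * z + Complex.I * c) rhp := by
    intro z _ w _ h
    have : (s : ℂ) ≠ 0 := Complex.ofReal_ne_zero.2 hs.ne'
    simpa [this] using h
  rw [lintegral_bergmanMeasure, lintegral_bergmanMeasure]
  conv_rhs => rw [← image_affine_rhp c hs]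
  rw [lintegral_image_holomorphic measurableSet_rhp hd hinj]
  refine setLIntegral_congr_fun measurableSet_rhp fun z hz => ?_
  have hz' : 0 < z.re := hz
  simp only [enorm_mul, mul_pow, ← mul_assoc]
  congr 1
  rw [← ofReal_norm, ← ENNReal.ofReal_pow (norm_nonneg _),
    ← ENNReal.ofReal_mul (by positivity), ← ENNReal.ofReal_mul (by positivity), hbs]
  congr 1
  simp [abs_of_pos hs]
  ring

theorem differentiableOn_affine {s : ℝ} (c : ℝ) (hs : 0 < s) {F : ℂ → ℂ}
    (hF : DifferentiableOn ℂ F rhp) :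
    DifferentiableOn ℂ (fun z => F (s * z + Complex.I * c)) rhp :=
  hF.comp (by fun_prop) fun _ hz => affine_mem_rhp hs hz

theorem exists_affine_isometry {b : ℂ} {s : ℝ} (c : ℝ) (hs : 0 < s)
    (hbs : ‖b‖ ^ 2 = s ^ (ℓ + 2)) :
    ∃ U : BergmanSpace ℓ →ₗᵢ[ℂ] BergmanSpace ℓ, ∀ ξ : BergmanSpace ℓ, ∀ z ∈ rhp,
      bval (U ξ) z = b * bval ξ (s * z + Complex.I * c) := by
  refine exists_isometry_to_bergman (σ := RingHom.id ℂ)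
    (fun ξ z => b * bval ξ (s * z + Complex.I * c)) ?_ ?_ ?_ ?_
  · exact fun ξ => (differentiableOn_affine c hs (bval_differentiableOn ξ)).const_mul b
  · intro x y z _
    rw [bval_add, mul_add]
  · intro a x z _
    rw [bval_smul, RingHom.id_apply]
    ring
  · intro ξ
    rw [bergman_enorm_sq, lintegral_affine c hs hbs]

theorem exists_affine_unitary {b : ℂ} {s : ℝ} (c : ℝ) (hs : 0 < s)
    (hbs : ‖b‖ ^ 2 = s ^ (ℓ + 2)) :
    ∃ U : BergmanSpace ℓ ≃ₗᵢ[ℂ] BergmanSpace ℓ,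
      (∀ ξ : BergmanSpace ℓ, ∀ z ∈ rhp, bval (U ξ) z = b * bval ξ (s * z + Complex.I * c)) ∧
      ∀ ξ : BergmanSpace ℓ, ∀ z ∈ rhp,
        bval (U.symm ξ) z = b⁻¹ * bval ξ ((z - Complex.I * c) / s) := by
  have hb : b ≠ 0 := by
    rintro rfl
    rw [norm_zero, zero_pow two_ne_zero] at hbs
    exact (pow_pos hs _).ne hbs
  obtain ⟨U, hU⟩ := exists_affine_isometry (ℓ := ℓ) c hs hbs
  -- The inverse is an operator of the same kind, coming from the inverse affine map `z ↦ s⁻¹ z - i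
  -- c / s`.
  obtain ⟨V, hV⟩ := exists_affine_isometry (ℓ := ℓ) (b := b⁻¹) (-(c / s)) (inv_pos.2 hs)
    (by rw [norm_inv, inv_pow, hbs, inv_pow])
  have hV' : ∀ ξ : BergmanSpace ℓ, ∀ z ∈ rhp,
      bval (V ξ) z = b⁻¹ * bval ξ ((z - Complex.I * c) / s) := by
    intro ξ z hz
    rw [hV ξ z hz]
    congr 2
    push_cast
    ring
  have hs' : (s : ℂ) ≠ 0 := Complex.ofReal_ne_zero.2 hs.ne'
  have hUV : ∀ ξ, U (V ξ) = ξ := fun ξ => bergman_ext fun z hz => by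
    rw [hU _ z hz, hV' _ _ (affine_mem_rhp hs hz), mul_inv_cancel_left₀ hb, add_sub_cancel_right,
      mul_div_cancel_left₀ _ hs']
  refine ⟨LinearIsometryEquiv.ofSurjective U fun ξ => ⟨V ξ, hUV ξ⟩, fun ξ => hU ξ, fun ξ => ?_⟩
  have : (LinearIsometryEquiv.ofSurjective U fun ξ => ⟨V ξ, hUV ξ⟩).symm ξ = V ξ := by
    rw [LinearIsometryEquiv.symm_apply_eq]
    exact (hUV ξ).symm
  rw [this]
  exact hV' ξ

end AffineOperators

/-! ### The conjugation `C_⋆`. -/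

section Inversion

variable {ℓ : ℕ}

theorem ne_zero_of_mem_rhp {z : ℂ} (hz : z ∈ rhp) : z ≠ 0 := by
  rintro rfl
  exact lt_irrefl (0 : ℝ) hz

theorem inv_mem_rhp {z : ℂ} (hz : z ∈ rhp) : z⁻¹ ∈ rhp := by
  have h0 := Complex.normSq_pos.2 (ne_zero_of_mem_rhp hz)
  have : 0 < z.re := hz
  simp only [rhp, mem_ofPred_eq, Complex.inv_re]
  positivity

theorem conj_mem_rhp {z : ℂ} (hz : z ∈ rhp) : conj z ∈ rhp := by
  simpa [rhp] using hz

theorem image_inv_rhp : (fun z : ℂ => z⁻¹) '' rhp = rhp := by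
  refine Subset.antisymm (image_subset_iff.2 fun z hz => inv_mem_rhp hz) fun z hz => ?_
  exact ⟨_, inv_mem_rhp hz, inv_inv z⟩

theorem lintegral_conj_rhp (G : ℂ → ENNReal) :
    ∫⁻ z in rhp, G (conj z) = ∫⁻ z in rhp, G z := by
  have hmp : MeasurePreserving (fun z : ℂ => conj z) volume volume :=
    Complex.conjLIE.measurePreserving
  have hemb : MeasurableEmbedding (fun z : ℂ => conj z) :=
    Complex.conjLIE.toHomeomorph.measurableEmbedding
  have := hmp.setLIntegral_comp_preimage_emb hemb G rhp
  rwa [show (fun z : ℂ => conj z) ⁻¹' rhp = rhp by ext z; simp [rhp]] at this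

/-- Inversion has Jacobian `‖z‖ ^ (-4)` and divides the real part by `‖z‖ ^ 2`, so the weight loses
`‖z‖ ^ (-2ℓ)`; the prefactor supplies both. As `z ↦ 1 / conj z` is not holomorphic, it is split into
`z ↦ z⁻¹` and a reflection preserving the measure. -/
theorem lintegral_inversion (F : ℂ → ℂ) :
    ∫⁻ z, ‖1 / z ^ (ℓ + 2) * conj (F (1 / conj z))‖ₑ ^ 2 ∂(bergmanMeasure ℓ) =
      ∫⁻ z, ‖F z‖ₑ ^ 2 ∂(bergmanMeasure ℓ) := by
  rw [lintegral_bergmanMeasure, lintegral_bergmanMeasure]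
  conv_rhs => rw [← image_inv_rhp, lintegral_image_holomorphic measurableSet_rhp
    (fun z hz => hasDerivAt_inv (ne_zero_of_mem_rhp hz)) inv_injective.injOn,
    ← lintegral_conj_rhp]
  refine setLIntegral_congr_fun measurableSet_rhp fun z hz => ?_
  have hz' : 0 < z.re := hz
  have hz0 := ne_zero_of_mem_rhp hz
  have hn : 0 < ‖z‖ := norm_pos_iff.2 hz0
  simp only [enorm_mul, mul_pow, ← mul_assoc]
  rw [RCLike.enorm_conj, one_div (conj z)]
  congr 1
  rw [← ofReal_norm, ← ENNReal.ofReal_pow (norm_nonneg _),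
    ← ENNReal.ofReal_mul (by positivity), ← ENNReal.ofReal_mul (by positivity)]
  congr 1
  simp only [norm_div, norm_one, norm_pow, norm_neg, norm_inv, RCLike.norm_conj, Complex.inv_re,
    Complex.conj_re, Complex.normSq_eq_norm_sq, div_pow]
  field_simp
  ring

theorem differentiableOn_inversion {F : ℂ → ℂ} (hF : DifferentiableOn ℂ F rhp) :
    DifferentiableOn ℂ (fun z => 1 / z ^ (ℓ + 2) * conj (F (1 / conj z))) rhp := by
  have h1 : DifferentiableOn ℂ (fun z => 1 / z ^ (ℓ + 2)) rhp := fun z hz => by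
    have := ne_zero_of_mem_rhp hz
    exact DifferentiableAt.differentiableWithinAt (by fun_prop (disch := positivity))
  have h2 : DifferentiableOn ℂ (fun z => F (1 / z)) rhp := by
    refine hF.comp (fun z hz => ?_) fun z hz => by simpa using inv_mem_rhp hz
    have := ne_zero_of_mem_rhp hz
    exact DifferentiableAt.differentiableWithinAt (by fun_prop (disch := assumption))
  refine h1.mul fun z hz => ?_
  have h3 := ((h2 _ (conj_mem_rhp hz)).differentiableAt (isOpen_rhp.mem_nhds (conj_mem_rhp hz)))
  -- Conjugating a holomorphic function both inside and outside keeps it holomorphic.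
  have := h3.conj_conj
  rw [Complex.conj_conj] at this
  exact this.differentiableWithinAt

theorem exists_inversion_conjugation (ℓ : ℕ) :
    ∃ C : BergmanSpace ℓ →ₗ⋆[ℂ] BergmanSpace ℓ,
      (∀ ξ : BergmanSpace ℓ, ∀ z ∈ rhp,
        bval (C ξ) z = 1 / z ^ (ℓ + 2) * conj (bval ξ (1 / conj z))) ∧
      IsConjugation C := by
  obtain ⟨C, hC⟩ := exists_isometry_to_bergman (ℓ := ℓ) (σ := starRingEnd ℂ)
    (fun (ξ : BergmanSpace ℓ) z => 1 / z ^ (ℓ + 2) * conj (bval ξ (1 / conj z)))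
    (fun ξ => differentiableOn_inversion (bval_differentiableOn ξ))
    (fun x y z _ => by rw [bval_add, map_add, mul_add])
    (fun a x z _ => by rw [bval_smul, map_mul]; ring)
    (fun ξ => by rw [bergman_enorm_sq, lintegral_inversion])
  refine ⟨C.toLinearMap, fun ξ z hz => hC ξ hz, C.norm_map, fun ξ => bergman_ext fun z hz => ?_⟩
  have hz0 := ne_zero_of_mem_rhp hz
  have hz1 : 1 / conj z ∈ rhp := by simpa using inv_mem_rhp (conj_mem_rhp hz)
  refine (hC _ hz).trans ?_
  change 1 / z ^ (ℓ + 2) * conj (bval (C ξ) (1 / conj z)) = _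
  rw [hC _ hz1]
  simp [hz0]

end Inversion

/-! ### Scaling of integrals on the line, and exponential decay against powers. -/

theorem lintegral_comp_const_mul {a : ℝ} (ha : 0 < a) (G : ℝ → ENNReal) :
    ENNReal.ofReal a * ∫⁻ t, G (a * t) = ∫⁻ t, G t := by
  have hemb : MeasurableEmbedding fun t : ℝ => a * t :=
    (Homeomorph.mulLeft₀ a ha.ne').measurableEmbedding
  conv_rhs => rw [← Real.smul_map_volume_mul_left ha.ne']
  rw [lintegral_smul_measure, abs_of_pos ha, smul_eq_mul, hemb.lintegral_map]

theorem lintegral_Ioi_comp_const_mul {a : ℝ} (ha : 0 < a) (G : ℝ → ENNReal) :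
    ENNReal.ofReal a * ∫⁻ t in Ioi 0, G (a * t) = ∫⁻ t in Ioi 0, G t := by
  rw [← lintegral_indicator measurableSet_Ioi, ← lintegral_indicator measurableSet_Ioi,
    ← lintegral_comp_const_mul ha ((Ioi 0).indicator G)]
  congr 1
  refine lintegral_congr fun t => ?_
  simp [indicator, mul_pos_iff_of_pos_left ha]

theorem pow_mul_exp_neg_le (n : ℕ) {a t : ℝ} (ha : 0 < a) (ht : 0 ≤ t) :
    t ^ n * Real.exp (-(a * t)) ≤ n.factorial / a ^ n := by
  have h := Real.pow_div_factorial_le_exp (a * t) (by positivity) n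
  rw [Real.exp_neg, ← div_eq_mul_inv, div_le_div_iff₀ (Real.exp_pos _) (by positivity)]
  rw [div_le_iff₀ (by positivity), mul_pow] at h
  linarith

/-! ### The Laplace transform as an isometry. -/

section LaplaceBasics

variable {ℓ : ℕ}

theorem lintegral_lebesgueMeasure (G : ℝ → ENNReal) :
    ∫⁻ t, G t ∂(lebesgueMeasure ℓ) =
      ∫⁻ t in Ioi 0, ENNReal.ofReal (Real.Gamma (1 + ℓ) / (2 ^ ℓ * t ^ (1 + ℓ))) * G t := by
  rw [lebesgueMeasure, lintegral_withDensity_eq_lintegral_mul_non_measurable _ (by fun_prop)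
    (by simp)]
  rfl

theorem lebesgue_weight_pos (ℓ : ℕ) {t : ℝ} (ht : 0 < t) :
    0 < Real.Gamma (1 + ℓ) / (2 ^ ℓ * t ^ (1 + ℓ)) :=
  div_pos (Real.Gamma_pos_of_pos (by positivity)) (by positivity)

theorem restrict_Ioi_absolutelyContinuous (ℓ : ℕ) :
    volume.restrict (Ioi (0 : ℝ)) ≪ lebesgueMeasure ℓ := by
  refine withDensity_absolutelyContinuous' (by fun_prop) ?_
  filter_upwards [ae_restrict_mem measurableSet_Ioi] with t ht
  simpa using lebesgue_weight_pos ℓ ht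

theorem ae_restrict_of_ae_lebesgue {p : ℝ → Prop} (h : ∀ᵐ t ∂(lebesgueMeasure ℓ), p t) :
    ∀ᵐ t ∂(volume.restrict (Ioi (0 : ℝ))), p t :=
  (restrict_Ioi_absolutelyContinuous ℓ).ae_le h

theorem ae_lebesgue_mem_Ioi (ℓ : ℕ) : ∀ᵐ t ∂(lebesgueMeasure ℓ), t ∈ Ioi (0 : ℝ) :=
  (withDensity_absolutelyContinuous _ _).ae_le (ae_restrict_mem measurableSet_Ioi)

theorem aestronglyMeasurable_restrict (h : LebesgueSpace ℓ) :
    AEStronglyMeasurable h (volume.restrict (Ioi (0 : ℝ))) :=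
  (Lp.aestronglyMeasurable h).mono_ac (restrict_Ioi_absolutelyContinuous ℓ)

/-- `h(t) e^{-zt}` is square integrable for the unweighted measure. -/
theorem memLp_two_laplaceIntegrand (h : LebesgueSpace ℓ) {z : ℂ} (hz : z ∈ rhp) :
    MemLp (laplaceIntegrand h z) 2 (volume.restrict (Ioi (0 : ℝ))) := by
  have hz' : 0 < z.re := hz
  have hm : AEStronglyMeasurable (laplaceIntegrand h z) (volume.restrict (Ioi (0 : ℝ))) :=
    (aestronglyMeasurable_restrict h).mul (Continuous.aestronglyMeasurable (by fun_prop))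
  rw [memLp_two_iff_lintegral hm]
  have hfin : ∫⁻ t, ‖h t‖ₑ ^ 2 ∂(lebesgueMeasure ℓ) ≠ ⊤ :=
    (memLp_two_iff_lintegral (Lp.aestronglyMeasurable h)).1 (Lp.memLp h)
  rw [lintegral_lebesgueMeasure] at hfin
  have hG := Real.Gamma_pos_of_pos (show (0 : ℝ) < 1 + ℓ by positivity)
  -- `K` bounds `exp (-2 t Re z)` divided by the weight of the Lebesgue space; the first factor
  -- bounds `t ^ (1 + ℓ) * exp (-2 t Re z)`.
  set K : ℝ := (1 + ℓ).factorial / (2 * z.re) ^ (1 + ℓ) * (2 ^ ℓ / Real.Gamma (1 + ℓ)) with hK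
  refine ne_top_of_le_ne_top (ENNReal.mul_ne_top (ENNReal.ofReal_ne_top (r := K)) hfin) ?_
  rw [← lintegral_const_mul' _ _ ENNReal.ofReal_ne_top]
  refine setLIntegral_mono' measurableSet_Ioi fun t ht => ?_
  have ht' : 0 < t := ht
  rw [laplaceIntegrand, enorm_mul, mul_pow, ← mul_assoc, mul_comm (‖h t‖ₑ ^ 2)]
  gcongr
  rw [← ofReal_norm, ← ENNReal.ofReal_pow (norm_nonneg _), ← ENNReal.ofReal_mul (by positivity)]
  refine ENNReal.ofReal_le_ofReal ?_
  have h1 := pow_mul_exp_neg_le (1 + ℓ) (show 0 < 2 * z.re by positivity) ht'.le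
  rw [Complex.norm_exp, ← Real.exp_nat_mul]
  have h2 : ((2 : ℕ) : ℝ) * (-(z * t)).re = -(2 * z.re * t) := by
    simp
    ring
  rw [h2, hK]
  calc Real.exp (-(2 * z.re * t)) =
        t ^ (1 + ℓ) * Real.exp (-(2 * z.re * t)) *
          ((2 ^ ℓ / Real.Gamma (1 + ℓ)) * (Real.Gamma (1 + ℓ) / (2 ^ ℓ * t ^ (1 + ℓ)))) := by
        field_simp
    _ ≤ _ := by
        rw [mul_assoc (_ / _)]
        gcongr

/-- Splitting `e^{-zt}` into two factors `e^{-zt/2}` writes the integrand as a product of two square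
integrable functions. -/
theorem integrable_laplaceIntegrand (h : LebesgueSpace ℓ) {z : ℂ} (hz : z ∈ rhp) :
    IntegrableOn (laplaceIntegrand h z) (Ioi 0) := by
  have hz' : 0 < z.re := hz
  have hz2 : z / 2 ∈ rhp := by
    simp only [rhp, mem_ofPred_eq]
    simp [hz']
  have h1 := memLp_two_laplaceIntegrand h hz2
  have h2 : MemLp (fun t : ℝ => Complex.exp (-(z / 2 * t))) 2 (volume.restrict (Ioi (0 : ℝ))) := by
    rw [memLp_two_iff_integrable_sq_norm (Continuous.aestronglyMeasurable (by fun_prop))]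
    have := integrableOn_exp_mul_Ioi (a := -z.re) (by linarith) 0
    refine this.congr_fun (fun t _ => ?_) measurableSet_Ioi
    simp only [Complex.norm_exp, ← Real.exp_nat_mul]
    congr 1
    simp
    ring
  refine (h1.integrable_mul h2).congr (Filter.Eventually.of_forall fun t => ?_)
  simp only [Pi.mul_apply, laplaceIntegrand, mul_assoc, ← Complex.exp_add]
  congr 2
  ring

theorem norm_laplaceIntegrand (h : ℝ → ℂ) (z : ℂ) (t : ℝ) :
    ‖laplaceIntegrand h z t‖ = ‖h t‖ * Real.exp (-(z.re * t)) := by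
  simp [laplaceIntegrand, Complex.norm_exp]

theorem differentiableOn_laplace (h : LebesgueSpace ℓ) :
    DifferentiableOn ℂ (laplace h) rhp := by
  intro z₀ hz₀
  have h0 : 0 < z₀.re := hz₀
  have hw : ((z₀.re / 4 : ℝ) : ℂ) ∈ rhp := by
    simp only [rhp, mem_ofPred_eq, Complex.ofReal_re]
    positivity
  have hopen : {z : ℂ | z₀.re / 2 < z.re} ∈ nhds z₀ :=
    (isOpen_lt continuous_const Complex.continuous_re).mem_nhds (by
      simp only [mem_ofPred_eq]; linarith)
  -- Near `z₀` the decay rate is at least `z₀.re / 2`. One half of it absorbs the factor `t`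
  -- produced by differentiation; the other half leaves the integrable integrand at `z₀.re / 4`.
  have key := hasDerivAt_integral_of_dominated_loc_of_deriv_le
    (μ := volume.restrict (Ioi (0 : ℝ))) (F := fun z t => laplaceIntegrand h z t)
    (F' := fun z t => -t * laplaceIntegrand h z t) (x₀ := z₀)
    (bound := fun t => (z₀.re / 4)⁻¹ * ‖laplaceIntegrand h ((z₀.re / 4 : ℝ) : ℂ) t‖)
    hopen ?_ (integrable_laplaceIntegrand h hz₀) ?_ ?_
    ((integrable_laplaceIntegrand h hw).norm.const_mul _) ?_
  · exact key.2.differentiableAt.differentiableWithinAt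
  · filter_upwards with z
    exact (aestronglyMeasurable_restrict h).mul (Continuous.aestronglyMeasurable (by fun_prop))
  · exact (Continuous.aestronglyMeasurable (by fun_prop)).mul
      (integrable_laplaceIntegrand h hz₀).aestronglyMeasurable
  · filter_upwards [ae_restrict_mem measurableSet_Ioi] with t ht z hz
    have ht' : 0 < t := ht
    have hz' : z₀.re / 2 < z.re := hz
    rw [norm_mul, norm_laplaceIntegrand, norm_laplaceIntegrand, norm_neg, Complex.norm_real,
      Real.norm_of_nonneg ht'.le, Complex.ofReal_re]
    have h1 := pow_mul_exp_neg_le 1 (show 0 < z₀.re / 4 by positivity) ht'.le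
    simp only [pow_one, Nat.factorial_one, Nat.cast_one, one_div] at h1
    calc t * (‖h t‖ * Real.exp (-(z.re * t)))
        ≤ t * (‖h t‖ * Real.exp (-(z₀.re / 2 * t))) := by gcongr
      _ = t * Real.exp (-(z₀.re / 4 * t)) * (‖h t‖ * Real.exp (-(z₀.re / 4 * t))) := by
          rw [mul_mul_mul_comm, mul_assoc t, mul_left_comm _ ‖h t‖, ← Real.exp_add]
          ring_nf
      _ ≤ _ := by gcongr
  · filter_upwards with t z _
    have h1 : HasDerivAt (fun z : ℂ => -(z * t)) (-(t : ℂ)) z := by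
      simpa using ((hasDerivAt_id z).mul_const (t : ℂ)).fun_neg
    refine (h1.cexp.const_mul (h t)).congr_deriv ?_
    rw [laplaceIntegrand]
    ring

/-- On a vertical line the Laplace transform is the Fourier transform of `h(t) e^{-xt}` cut off to
`(0,∞)`. The substitution `y = 2πw` matches the normalisation and produces the factor `2π`. -/
theorem lintegral_laplace_vertical (h : LebesgueSpace ℓ) {x : ℝ} (hx : 0 < x) :
    ∫⁻ y : ℝ, ‖laplace h (x + y * Complex.I)‖ₑ ^ 2 =
      ENNReal.ofReal (2 * Real.pi) *
        ∫⁻ t in Ioi 0, ENNReal.ofReal (Real.exp (-(2 * x * t))) * ‖h t‖ₑ ^ 2 := by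
  have hxr : (x : ℂ) ∈ rhp := by simpa [rhp] using hx
  set f : ℝ → ℂ := (Ioi (0 : ℝ)).indicator (laplaceIntegrand h x) with hf
  have hf1 : Integrable f :=
    (integrable_indicator_iff measurableSet_Ioi).2 (integrable_laplaceIntegrand h hxr)
  have hf2 : MemLp f 2 volume :=
    (memLp_indicator_iff_restrict measurableSet_Ioi).2 (memLp_two_laplaceIntegrand h hxr)
  have hF : ∀ w : ℝ, laplace h (x + ((2 * Real.pi * w : ℝ) : ℂ) * Complex.I) =
      FourierTransform.fourier f w := by
    intro w
    rw [Real.fourier_real_eq_integral_exp_smul, laplace, ← integral_indicator measurableSet_Ioi]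
    refine integral_congr_ae (Filter.Eventually.of_forall fun t => ?_)
    by_cases ht : t ∈ Ioi (0 : ℝ)
    · simp only [hf, indicator_of_mem ht, laplaceIntegrand, smul_eq_mul]
      rw [mul_left_comm, ← Complex.exp_add]
      congr 2
      push_cast
      ring
    · simp [hf, indicator_of_notMem ht]
  rw [← lintegral_comp_const_mul (a := 2 * Real.pi) (by positivity)]
  simp only [hF]
  rw [lintegral_fourier_sq hf1 hf2]
  congr 1
  rw [← lintegral_indicator measurableSet_Ioi]
  refine lintegral_congr fun t => ?_
  by_cases ht : t ∈ Ioi (0 : ℝ)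
  · rw [hf, indicator_of_mem ht, indicator_of_mem ht, ← ofReal_norm, ← ofReal_norm,
      norm_laplaceIntegrand, ENNReal.ofReal_mul (norm_nonneg _), mul_pow, mul_comm,
      ← ENNReal.ofReal_pow (Real.exp_nonneg _), ← Real.exp_nat_mul]
    congr 3
    simp
    ring
  · simp [hf, indicator_of_notMem ht]

/-- This Gamma integral is where the weight of the Lebesgue space comes from; the `2` is `2π` from
Plancherel divided by the `π` of the Bergman measure. -/
theorem lintegral_pow_mul_exp (ℓ : ℕ) {t : ℝ} (ht : 0 < t) :
    ∫⁻ x in Ioi (0 : ℝ), ENNReal.ofReal (2 * (x ^ ℓ * Real.exp (-(2 * x * t)))) =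
      ENNReal.ofReal (Real.Gamma (1 + ℓ) / (2 ^ ℓ * t ^ (1 + ℓ))) := by
  have hG := Real.Gamma_pos_of_pos (show (0 : ℝ) < 1 + ℓ by positivity)
  have key := Real.integral_rpow_mul_exp_neg_mul_Ioi (a := 1 + ℓ) (r := 2 * t) (by positivity)
    (by positivity)
  have e : ∀ x : ℝ, x ^ ((1 + ℓ : ℝ) - 1) * Real.exp (-(2 * t * x)) =
      x ^ ℓ * Real.exp (-(2 * x * t)) := by
    intro x
    rw [add_sub_cancel_left, Real.rpow_natCast]
    ring_nf
  simp only [e] at key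
  have hi : IntegrableOn (fun x => x ^ ℓ * Real.exp (-(2 * x * t))) (Ioi 0) :=
    -- A non-integrable function has integral `0` by convention, so a nonzero value proves
    -- integrability.
    .of_integral_ne_zero (by rw [key]; positivity)
  rw [← ofReal_integral_eq_lintegral_ofReal (hi.const_mul 2), integral_const_mul, key]
  · congr 1
    rw [show (1 + ℓ : ℝ) = ((1 + ℓ : ℕ) : ℝ) by push_cast; ring, Real.rpow_natCast,
      one_div, inv_pow, mul_pow, pow_add 2, pow_one]
    field_simp
  · filter_upwards [ae_restrict_mem measurableSet_Ioi] with x hx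
    have : 0 < x := hx
    simp only [Pi.zero_apply]
    positivity

/-- The half-plane is sliced into vertical lines, each slice is evaluated by Plancherel, and Tonelli
lets the integral over `x` be done first. -/
theorem lintegral_laplace_sq (h : LebesgueSpace ℓ) :
    ∫⁻ z, ‖laplace h z‖ₑ ^ 2 ∂(bergmanMeasure ℓ) = ‖h‖ₑ ^ 2 := by
  rw [Lp_enorm_sq, lintegral_lebesgueMeasure, lintegral_bergmanMeasure]
  set G : ℂ → ENNReal := fun z => ENNReal.ofReal (z.re ^ ℓ / Real.pi) * ‖laplace h z‖ₑ ^ 2 with hG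
  have hGm : AEMeasurable (rhp.indicator G) volume := by
    rw [aemeasurable_indicator_iff measurableSet_rhp]
    have h1 : AEMeasurable (laplace h) (volume.restrict rhp) :=
      (differentiableOn_laplace h).continuousOn.aemeasurable measurableSet_rhp
    fun_prop
  have hmp := Complex.volume_preserving_equiv_real_prod.symm
  have hGm2 : AEMeasurable (fun p => rhp.indicator G (Complex.measurableEquivRealProd.symm p))
      (volume.prod volume) := by
    rw [← Measure.volume_eq_prod]
    exact (hmp.map_eq ▸ hGm).comp_measurable hmp.measurable
  rw [← lintegral_indicator measurableSet_rhp,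
    ← hmp.lintegral_comp_emb Complex.measurableEquivRealProd.symm.measurableEmbedding,
    Measure.volume_eq_prod, lintegral_prod _ hGm2]
  have step1 : ∀ x : ℝ,
      ∫⁻ y : ℝ, rhp.indicator G (Complex.measurableEquivRealProd.symm (x, y)) =
        (Ioi (0 : ℝ)).indicator (fun x => ∫⁻ t in Ioi (0 : ℝ),
          ENNReal.ofReal (2 * (x ^ ℓ * Real.exp (-(2 * x * t)))) * ‖h t‖ₑ ^ 2) x := by
    intro x
    by_cases hx : 0 < x
    · rw [indicator_of_mem (show x ∈ Ioi 0 from hx)]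
      have e : ∀ y : ℝ, rhp.indicator G (Complex.measurableEquivRealProd.symm (x, y)) =
          ENNReal.ofReal (x ^ ℓ / Real.pi) * ‖laplace h (x + y * Complex.I)‖ₑ ^ 2 := by
        intro y
        have : Complex.measurableEquivRealProd.symm (x, y) = x + y * Complex.I := by
          simp [Complex.measurableEquivRealProd_symm_apply, Complex.mk_eq_add_mul_I]
        rw [this, indicator_of_mem (by simpa [rhp] using hx)]
        simp [hG]
      simp only [e]
      rw [lintegral_const_mul' _ _ ENNReal.ofReal_ne_top, lintegral_laplace_vertical h hx,
        ← mul_assoc, ← ENNReal.ofReal_mul (by positivity),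
        ← lintegral_const_mul' _ _ ENNReal.ofReal_ne_top]
      refine lintegral_congr fun t => ?_
      rw [← mul_assoc, ← ENNReal.ofReal_mul (by positivity)]
      congr 2
      field_simp
    · rw [indicator_of_notMem (by simpa using hx)]
      have e : ∀ y : ℝ, rhp.indicator G (Complex.measurableEquivRealProd.symm (x, y)) = 0 := by
        intro y
        refine indicator_of_notMem ?_ _
        simpa [rhp, Complex.measurableEquivRealProd_symm_apply] using hx
      simp only [e, lintegral_zero]
  simp only [step1]
  rw [lintegral_indicator measurableSet_Ioi, lintegral_lintegral_swap]
  · refine setLIntegral_congr_fun measurableSet_Ioi fun t ht => ?_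
    rw [lintegral_mul_const' _ _ (by simp), lintegral_pow_mul_exp ℓ ht]
  · have h1 : AEMeasurable (fun p : ℝ × ℝ => h p.2)
        ((volume.restrict (Ioi 0)).prod (volume.restrict (Ioi 0))) :=
      (aestronglyMeasurable_restrict h).aemeasurable.comp_snd
    simp only [Function.uncurry_def]
    fun_prop

theorem laplace_congr_ae {f g : ℝ → ℂ} (hfg : f =ᵐ[lebesgueMeasure ℓ] g) (z : ℂ) :
    laplace f z = laplace g z := by
  refine integral_congr_ae ?_
  filter_upwards [ae_restrict_of_ae_lebesgue hfg] with t ht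
  rw [laplaceIntegrand, laplaceIntegrand, ht]

theorem exists_laplace_isometry (ℓ : ℕ) :
    ∃ L : LebesgueSpace ℓ →ₗᵢ[ℂ] BergmanSpace ℓ, ∀ h : LebesgueSpace ℓ, ∀ z ∈ rhp,
      bval (L h) z = laplace h z := by
  refine exists_isometry_to_bergman (σ := RingHom.id ℂ) (fun h : LebesgueSpace ℓ => laplace h)
    differentiableOn_laplace ?_ ?_ lintegral_laplace_sq
  · intro h k z hz
    rw [laplace_congr_ae (Lp.coeFn_add h k), laplace, laplace, laplace,
      ← integral_add (integrable_laplaceIntegrand h hz) (integrable_laplaceIntegrand k hz)]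
    simp only [laplaceIntegrand, Pi.add_apply, add_mul]
  · intro a h z _
    rw [laplace_congr_ae (Lp.coeFn_smul a h), laplace, laplace, RingHom.id_apply,
      ← integral_const_mul]
    simp only [laplaceIntegrand, Pi.smul_apply, smul_eq_mul, mul_assoc]

end LaplaceBasics

/-! ### Weighted dilations and their Laplace transforms. -/

section Dilation

variable {ℓ : ℕ} {lam : ℝ} {a : ℝ} {θ : ℂ} {ψ : ℝ → ℂ}

/-- Since `a` is real, the exponential is unimodular and `‖ψ‖` is the constant `‖θ‖ / lam`; the
dilation changes the weighted measure only by a constant factor. The parameters are free because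
surjectivity of the Laplace transform uses other values. -/
theorem memLp_wcomp_dilation (hlam : 0 < lam)
    (hψ : ∀ t : ℝ, 0 < t → ψ t = θ / lam * Complex.exp (-(t * (Complex.I * a) / lam)))
    (h : LebesgueSpace ℓ) :
    MemLp (wcomp ψ (fun t => t / lam) h) 2 (lebesgueMeasure ℓ) := by
  have hm : AEStronglyMeasurable (wcomp ψ (fun t => t / lam) h) (lebesgueMeasure ℓ) := by
    have h1 := (Lp.aestronglyMeasurable h).comp_quasiMeasurePreserving
      (quasiMeasurePreserving_div ℓ hlam)
    have h2 : AEStronglyMeasurable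
        (fun t : ℝ => θ / lam * Complex.exp (-(t * (Complex.I * a) / lam))) (lebesgueMeasure ℓ) :=
      Continuous.aestronglyMeasurable (by fun_prop)
    refine (h2.mul h1).congr ?_
    filter_upwards [ae_lebesgue_mem_Ioi ℓ] with t ht
    simp [wcomp, hψ t ht]
  rw [memLp_two_iff_lintegral hm]
  have hfin := (memLp_two_iff_lintegral (Lp.aestronglyMeasurable h)).1 (Lp.memLp h)
  rw [lintegral_lebesgueMeasure] at hfin ⊢
  rw [← lintegral_Ioi_comp_const_mul hlam]
  refine ENNReal.mul_ne_top ENNReal.ofReal_ne_top ?_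
  refine ne_of_eq_of_ne ?_ (ENNReal.mul_ne_top
    (ENNReal.ofReal_ne_top (r := (‖θ‖ / lam) ^ 2 / lam ^ (1 + ℓ))) hfin)
  rw [← lintegral_const_mul' _ _ ENNReal.ofReal_ne_top]
  refine setLIntegral_congr_fun measurableSet_Ioi fun t ht => ?_
  have ht' : 0 < t := ht
  have e : ‖ψ (lam * t)‖ = ‖θ‖ / lam := by
    rw [hψ _ (mul_pos hlam ht'), norm_mul, Complex.norm_exp, norm_div, Complex.norm_real,
      Real.norm_of_nonneg hlam.le]
    have : (-(((lam * t : ℝ) : ℂ) * (Complex.I * a) / lam)).re = 0 := by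
      simp [Complex.div_re]
    rw [this, Real.exp_zero, mul_one]
  have hG := Real.Gamma_pos_of_pos (show (0 : ℝ) < 1 + ℓ by positivity)
  simp only [wcomp]
  rw [mul_div_cancel_left₀ _ hlam.ne', enorm_mul,
    mul_pow ‖ψ (lam * t)‖ₑ, ← mul_assoc, ← mul_assoc]
  congr 1
  rw [← ofReal_norm, ← ENNReal.ofReal_pow (norm_nonneg _), e,
    ← ENNReal.ofReal_mul (by positivity), ← ENNReal.ofReal_mul (by positivity)]
  congr 1
  rw [mul_pow lam]
  field_simp

/-- The substitution cancels `1 / lam`, and the phase turns into an imaginary shift of `z`. No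
integrability is needed: the scaling formula for Bochner integrals is unconditional. -/
theorem laplace_wcomp_dilation (hlam : 0 < lam)
    (hψ : ∀ t : ℝ, 0 < t → ψ t = θ / lam * Complex.exp (-(t * (Complex.I * a) / lam)))
    (h : ℝ → ℂ) (z : ℂ) :
    laplace (wcomp ψ (fun t => t / lam) h) z = θ * laplace h (lam * z + Complex.I * a) := by
  have hl : (lam : ℂ) ≠ 0 := Complex.ofReal_ne_zero.2 hlam.ne'
  have key := integral_comp_mul_left_Ioi
    (fun t => laplaceIntegrand (wcomp ψ (fun t => t / lam) h) z t) 0 hlam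
  rw [mul_zero] at key
  rw [laplace, laplace, ← integral_const_mul]
  have key2 := congrArg (fun w => lam • w) key
  simp only [smul_inv_smul₀ hlam.ne'] at key2
  rw [← key2, ← integral_smul]
  refine setIntegral_congr_fun measurableSet_Ioi fun t ht => ?_
  have ht' : 0 < t := ht
  simp only [laplaceIntegrand, wcomp]
  rw [hψ _ (mul_pos hlam ht'), mul_div_cancel_left₀ _ hlam.ne', Complex.real_smul]
  have : Complex.exp (-((lam * z + Complex.I * a) * t)) =
      Complex.exp (-(((lam * t : ℝ) : ℂ) * (Complex.I * a) / lam)) *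
        Complex.exp (-(z * ((lam * t : ℝ) : ℂ))) := by
    rw [← Complex.exp_add]
    congr 1
    push_cast
    field_simp
    ring
  rw [this]
  field_simp

end Dilation

/-! ### The reproducing kernel at `1` and surjectivity of the Laplace transform. -/

section Kernel

/-- In polar coordinates the radial weight is constant on each circle, where the mean value property
replaces `H` by `H 0`. -/
theorem integral_ball_radial_mul {H : ℂ → ℂ} (hH : DifferentiableOn ℂ H (Metric.ball 0 1))
    {w : ℝ → ℝ} (hw : Continuous w)
    (hint : IntegrableOn (fun ζ => (w ‖ζ‖ : ℂ) * H ζ) (Metric.ball 0 1)) :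
    ∫ ζ in Metric.ball (0 : ℂ) 1, (w ‖ζ‖ : ℂ) * H ζ =
      ((∫ r in (0 : ℝ)..1, 2 * Real.pi * (r * w r) : ℝ) : ℂ) * H 0 := by
  set F : ℂ → ℂ := (Metric.ball (0 : ℂ) 1).indicator (fun ζ => (w ‖ζ‖ : ℂ) * H ζ) with hF
  have hFm : Measurable F := by
    classical
    have hc : ContinuousOn (fun ζ => (w ‖ζ‖ : ℂ) * H ζ) (Metric.ball 0 1) :=
      (Continuous.continuousOn (by fun_prop)).mul hH.continuousOn
    have := hc.measurable_piecewise (g := fun _ => (0 : ℂ)) continuousOn_const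
      Metric.isOpen_ball.measurableSet
    rw [hF, ← piecewise_eq_indicator]
    exact this
  have hFi : Integrable F := (integrable_indicator_iff Metric.isOpen_ball.measurableSet).2 hint
  have hpc : Continuous fun p : ℝ × ℝ => Complex.polarCoord.symm p := by
    simp only [Complex.polarCoord_symm_apply]
    fun_prop
  have hPi : Integrable (fun p : ℝ × ℝ => p.1 • F (Complex.polarCoord.symm p))
      ((volume.restrict (Ioi (0 : ℝ))).prod (volume.restrict (Ioo (-Real.pi) Real.pi))) := by
    rw [Measure.prod_restrict, ← Measure.volume_eq_prod]
    refine ⟨(measurable_fst.smul (hFm.comp hpc.measurable)).aestronglyMeasurable, ?_⟩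
    have h1 := Complex.lintegral_comp_polarCoord_symm fun z => ‖F z‖ₑ
    rw [polarCoord_target] at h1
    rw [HasFiniteIntegral]
    refine lt_of_eq_of_lt ?_ (h1.trans_lt hFi.2)
    refine setLIntegral_congr_fun (measurableSet_Ioi.prod measurableSet_Ioo) fun p hp => ?_
    have hp1 : 0 < p.1 := hp.1
    simp only [enorm_smul, smul_eq_mul]
    rw [Real.enorm_of_nonneg hp1.le]
  rw [← integral_indicator Metric.isOpen_ball.measurableSet, ← hF,
    ← Complex.integral_comp_polarCoord_symm, polarCoord_target, Measure.volume_eq_prod,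
    ← Measure.prod_restrict, integral_prod _ hPi]
  have step : ∀ r ∈ Ioi (0 : ℝ),
      ∫ θ in Ioo (-Real.pi) Real.pi, r • F (Complex.polarCoord.symm (r, θ)) =
        (Ioo (0 : ℝ) 1).indicator (fun r => ((2 * Real.pi * (r * w r) : ℝ) : ℂ) * H 0) r := by
    intro r hr
    have hr0 : 0 < r := hr
    have e : ∀ θ : ℝ, Complex.polarCoord.symm (r, θ) = circleMap 0 r θ := fun θ => by
      rw [Complex.polarCoord_symm_apply, circleMap_zero, Complex.exp_mul_I, Complex.ofReal_cos,
        Complex.ofReal_sin]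
    have hn : ∀ θ : ℝ, ‖circleMap 0 r θ‖ = r := fun θ => by
      rw [norm_circleMap_zero, abs_of_pos hr0]
    simp only [e]
    by_cases hr1 : r < 1
    · have hmem : ∀ θ : ℝ, circleMap 0 r θ ∈ Metric.ball (0 : ℂ) 1 := fun θ => by
        rw [mem_ball_zero_iff, hn]
        exact hr1
      have hmean : Real.circleAverage H 0 r = H 0 := by
        refine DiffContOnCl.circleAverage (DifferentiableOn.diffContOnCl_ball hH ?_)
        rw [abs_of_pos hr0]
        exact Metric.closedBall_subset_ball hr1
      have hpi : (2 * Real.pi : ℝ) ≠ 0 := by positivity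
      -- The mean over a full period is shifted to the angular range `(-π, π)` of polar coordinates.
      rw [Real.circleAverage_eq_integral_add (-Real.pi), intervalIntegral.integral_comp_add_right
        (fun θ => H (circleMap 0 r θ)), zero_add,
        show 2 * Real.pi + -Real.pi = Real.pi by ring, inv_smul_eq_iff₀ hpi] at hmean
      simp only [hF, indicator_of_mem (hmem _), hn]
      rw [indicator_of_mem (show r ∈ Ioo (0 : ℝ) 1 from ⟨hr0, hr1⟩), integral_smul,
        integral_const_mul, ← integral_Ioc_eq_integral_Ioo, ← intervalIntegral.integral_of_le
          (by linarith [Real.pi_pos]), hmean, Complex.real_smul, Complex.real_smul]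
      push_cast
      ring
    · have hmem : ∀ θ : ℝ, circleMap 0 r θ ∉ Metric.ball (0 : ℂ) 1 := fun θ => by
        rw [mem_ball_zero_iff, hn]
        exact hr1
      rw [indicator_of_notMem fun h => hr1 h.2]
      simp only [hF, indicator_of_notMem (hmem _), smul_zero, integral_zero]
  rw [setIntegral_congr_fun measurableSet_Ioi step, setIntegral_indicator measurableSet_Ioo,
    show Ioi (0 : ℝ) ∩ Ioo 0 1 = Ioo 0 1 from inter_eq_right.2 fun x hx => hx.1,
    integral_mul_const, integral_complex_ofReal, intervalIntegral.integral_of_le zero_le_one,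
    integral_Ioc_eq_integral_Ioo]

theorem one_sub_ne_zero_of_mem_ball {ζ : ℂ} (hζ : ζ ∈ Metric.ball (0 : ℂ) 1) : 1 - ζ ≠ 0 := by
  intro h
  rw [mem_ball_zero_iff, ← sub_eq_zero.1 h, norm_one] at hζ
  exact lt_irrefl _ hζ

theorem cayley_re (ζ : ℂ) : ((1 + ζ) / (1 - ζ)).re = (1 - ‖ζ‖ ^ 2) / ‖1 - ζ‖ ^ 2 := by
  rw [Complex.div_re, ← Complex.normSq_eq_norm_sq ζ, ← Complex.normSq_eq_norm_sq (1 - ζ),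
    Complex.normSq_apply ζ]
  simp
  ring

theorem cayley_mem_rhp {ζ : ℂ} (hζ : ζ ∈ Metric.ball (0 : ℂ) 1) : (1 + ζ) / (1 - ζ) ∈ rhp := by
  have h0 := norm_pos_iff.2 (one_sub_ne_zero_of_mem_ball hζ)
  rw [mem_ball_zero_iff] at hζ
  have h1 : ‖ζ‖ ^ 2 < 1 := pow_lt_one₀ (norm_nonneg _) hζ two_ne_zero
  have h2 : 0 < 1 - ‖ζ‖ ^ 2 := by linarith
  simp only [rhp, mem_ofPred_eq, cayley_re]
  positivity

theorem one_add_ne_zero_of_mem_rhp {z : ℂ} (hz : z ∈ rhp) : 1 + z ≠ 0 := by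
  intro h
  have hz' : 0 < z.re := hz
  have := congrArg Complex.re h
  simp at this
  linarith

theorem image_cayley : (fun ζ : ℂ => (1 + ζ) / (1 - ζ)) '' Metric.ball 0 1 = rhp := by
  refine Subset.antisymm (image_subset_iff.2 fun ζ hζ => cayley_mem_rhp hζ) fun z hz => ?_
  have hz' : 0 < z.re := hz
  have h0 := one_add_ne_zero_of_mem_rhp hz
  refine ⟨(z - 1) / (1 + z), ?_, ?_⟩
  · rw [mem_ball_zero_iff, norm_div, div_lt_one (norm_pos_iff.2 h0)]
    refine lt_of_pow_lt_pow_left₀ 2 (norm_nonneg _) ?_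
    rw [← Complex.normSq_eq_norm_sq, ← Complex.normSq_eq_norm_sq, Complex.normSq_apply,
      Complex.normSq_apply]
    simp
    nlinarith
  · have h1 : 1 - (z - 1) / (1 + z) = 2 / (1 + z) := by
      field_simp
      ring
    simp only
    rw [h1]
    field_simp
    ring

theorem hasDerivAt_cayley {ζ : ℂ} (hζ : ζ ∈ Metric.ball (0 : ℂ) 1) :
    HasDerivAt (fun ζ : ℂ => (1 + ζ) / (1 - ζ)) (2 / (1 - ζ) ^ 2) ζ := by
  have h := ((hasDerivAt_id ζ).const_add 1).div ((hasDerivAt_id ζ).const_sub 1)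
    (one_sub_ne_zero_of_mem_ball hζ)
  refine h.congr_deriv ?_
  simp only [id]
  ring

theorem injOn_cayley : InjOn (fun ζ : ℂ => (1 + ζ) / (1 - ζ)) (Metric.ball 0 1) := by
  intro ζ hζ ξ hξ h
  simp only at h
  rw [div_eq_div_iff (one_sub_ne_zero_of_mem_ball hζ) (one_sub_ne_zero_of_mem_ball hξ)] at h
  linear_combination h / 2

variable {ℓ : ℕ}

theorem inner_bergman (h k : BergmanSpace ℓ) :
    inner ℂ h k = ∫ z in rhp, ((z.re ^ ℓ / Real.pi : ℝ) : ℂ) * (conj (bval h z) * bval k z) := by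
  have h1 : inner ℂ h k = ∫ z, conj (bval h z) * bval k z ∂(bergmanMeasure ℓ) := by
    rw [Submodule.coe_inner, L2.inner_def]
    refine integral_congr_ae ?_
    filter_upwards [bval_ae_eq h, bval_ae_eq k] with z h1 h2
    rw [h1, h2, RCLike.inner_apply, mul_comm]
  rw [h1, bergmanMeasure, integral_withDensity_eq_integral_toReal_smul (by fun_prop) (by simp)]
  refine setIntegral_congr_fun measurableSet_rhp fun z hz => ?_
  have hz' : 0 < z.re := hz
  rw [ENNReal.toReal_ofReal (by positivity), Complex.real_smul]

theorem integrableOn_inner_bergman (h k : BergmanSpace ℓ) :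
    IntegrableOn (fun z => ((z.re ^ ℓ / Real.pi : ℝ) : ℂ) * (conj (bval h z) * bval k z)) rhp := by
  have h1 : Integrable (fun z => conj (bval h z) * bval k z) (bergmanMeasure ℓ) := by
    refine (L2.integrable_inner (𝕜 := ℂ) (h : Lp ℂ 2 (bergmanMeasure ℓ)) k).congr ?_
    filter_upwards [bval_ae_eq h, bval_ae_eq k] with z h1 h2
    rw [h1, h2, RCLike.inner_apply, mul_comm]
  rw [bergmanMeasure, integrable_withDensity_iff_integrable_smul₀' (by fun_prop) (by simp)] at h1
  refine IntegrableOn.congr_fun h1 (fun z hz => ?_) measurableSet_rhp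
  have hz' : 0 < z.re := hz
  rw [ENNReal.toReal_ofReal (by positivity), Complex.real_smul]

/-- An element orthogonal to the reproducing kernel at `1` vanishes there. -/
theorem bval_one_eq_zero_of_inner_kernel {h k : BergmanSpace ℓ} {M : ℝ} (hM : M ≠ 0)
    (hk : ∀ z ∈ rhp, bval k z = M / (1 + z) ^ (ℓ + 2)) (hkh : inner ℂ k h = 0) :
    bval h 1 = 0 := by
  -- In the Cayley coordinate the Jacobian `4 / ‖1 - ζ‖ ^ 4`, the factor `‖1 - ζ‖ ^ (-2ℓ)` of the
  -- weight and the conjugated kernel combine so that every power of `conj (1 - ζ)` cancels. What is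
  -- left is a radial weight times this holomorphic `H`, and `H 0` is a nonzero multiple of `bval h
  -- 1`.
  set H : ℂ → ℂ := fun ζ => (4 * M / (Real.pi * 2 ^ (ℓ + 2)) : ℝ) *
    (bval h ((1 + ζ) / (1 - ζ)) / (1 - ζ) ^ (ℓ + 2)) with hH
  have hHd : DifferentiableOn ℂ H (Metric.ball 0 1) := by
    have h1 : DifferentiableOn ℂ (fun ζ => bval h ((1 + ζ) / (1 - ζ))) (Metric.ball 0 1) :=
      (bval_differentiableOn h).comp
        (fun ζ hζ => (hasDerivAt_cayley hζ).differentiableAt.differentiableWithinAt)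
        fun ζ hζ => cayley_mem_rhp hζ
    exact (h1.div (by fun_prop)
      fun ζ hζ => pow_ne_zero _ (one_sub_ne_zero_of_mem_ball hζ)).const_mul _
  have e : EqOn (fun ζ : ℂ => ((‖2 / (1 - ζ) ^ 2‖ ^ 2 : ℝ) : ℂ) *
      (((((1 + ζ) / (1 - ζ)).re ^ ℓ / Real.pi : ℝ) : ℂ) *
        (conj (bval k ((1 + ζ) / (1 - ζ))) * bval h ((1 + ζ) / (1 - ζ)))))
      (fun ζ => (((1 - ‖ζ‖ ^ 2) ^ ℓ : ℝ) : ℂ) * H ζ) (Metric.ball 0 1) := by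
    intro ζ hζ
    have h0 := one_sub_ne_zero_of_mem_ball hζ
    have hc0 : conj (1 - ζ) ≠ 0 := (map_ne_zero _).2 h0
    have h1 : 1 + (1 + ζ) / (1 - ζ) = 2 / (1 - ζ) := by
      field_simp
      ring
    have hn : ((‖1 - ζ‖ : ℝ) : ℂ) ^ 2 = (1 - ζ) * conj (1 - ζ) := (Complex.mul_conj' _).symm
    simp only [hH]
    rw [hk _ (cayley_mem_rhp hζ), h1, cayley_re]
    simp only [map_div₀, map_pow, Complex.conj_ofReal, norm_div, norm_pow, Complex.ofReal_div,
      Complex.ofReal_pow, Complex.ofReal_mul, map_ofNat, div_pow, hn, Complex.norm_ofNat,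
      Complex.ofReal_ofNat]
    have hpi : (Real.pi : ℂ) ≠ 0 := Complex.ofReal_ne_zero.2 Real.pi_ne_zero
    -- With `1 - ζ` and its conjugate replaced by independent nonzero variables, the claim is a
    -- rational identity.
    clear_value H
    generalize bval h ((1 + ζ) / (1 - ζ)) = B
    generalize conj (1 - ζ) = v at hc0
    generalize 1 - ζ = u at h0
    field_simp
    ring
  have hcv := integral_image_holomorphic Metric.isOpen_ball.measurableSet
    (fun ζ hζ => hasDerivAt_cayley hζ) injOn_cayley
    (fun z => ((z.re ^ ℓ / Real.pi : ℝ) : ℂ) * (conj (bval k z) * bval h z))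
  have hci := (integrableOn_image_holomorphic Metric.isOpen_ball.measurableSet
    (fun ζ hζ => hasDerivAt_cayley hζ) injOn_cayley
    (fun z => ((z.re ^ ℓ / Real.pi : ℝ) : ℂ) * (conj (bval k z) * bval h z))).1
    (by rw [image_cayley]; exact integrableOn_inner_bergman k h)
  rw [image_cayley, ← inner_bergman, hkh, setIntegral_congr_fun Metric.isOpen_ball.measurableSet e,
    integral_ball_radial_mul hHd (w := fun r => (1 - r ^ 2) ^ ℓ) (by fun_prop)
      (hci.congr_fun e Metric.isOpen_ball.measurableSet)] at hcv
  have hpos : 0 < ∫ r in (0 : ℝ)..1, 2 * Real.pi * (r * (1 - r ^ 2) ^ ℓ) := by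
    refine intervalIntegral.intervalIntegral_pos_of_pos_on
      (Continuous.intervalIntegrable (by fun_prop) _ _) (fun r hr => ?_) one_pos
    have h1 : 0 < r := hr.1
    have h2 : 0 < 1 - r ^ 2 := by nlinarith [hr.1, hr.2]
    positivity
  have h0 := (mul_eq_zero.1 hcv.symm).resolve_left (Complex.ofReal_ne_zero.2 hpos.ne')
  simp only [hH, add_zero, sub_zero, div_one, one_pow] at h0
  refine (mul_eq_zero.1 h0).resolve_left (Complex.ofReal_ne_zero.2 ?_)
  have := Real.pi_ne_zero
  positivity

/-- The function `t ^ (ℓ + 1) e^{-t}` works with `M = (ℓ + 1)!`: a Gamma integral gives the formula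
on the positive reals, and the identity theorem extends it to the half-plane. -/
theorem exists_laplace_kernel (ℓ : ℕ) : ∃ h : LebesgueSpace ℓ, ∃ M : ℝ, M ≠ 0 ∧ ∀ z ∈ rhp,
    laplace h z = M / (1 + z) ^ (ℓ + 2) := by
  have hm : MemLp (fun t : ℝ => (t : ℂ) ^ (ℓ + 1) * Complex.exp (-t)) 2 (lebesgueMeasure ℓ) := by
    rw [memLp_two_iff_lintegral (Continuous.aestronglyMeasurable (by fun_prop)),
      lintegral_lebesgueMeasure]
    have hG := Real.Gamma_pos_of_pos (show (0 : ℝ) < 1 + ℓ by positivity)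
    -- The weighted square is a multiple of `t ^ (ℓ + 1) e^{-2t}`, a Gamma integral with `ℓ + 1` in
    -- place of `ℓ`; the extra `2` in the denominator offsets the factor in that lemma.
    refine ne_of_eq_of_ne ?_ (ENNReal.mul_ne_top
      (ENNReal.ofReal_ne_top (r := Real.Gamma (1 + ℓ) / (2 ^ ℓ * 2)))
      (ne_of_eq_of_ne (lintegral_pow_mul_exp (ℓ + 1) one_pos) ENNReal.ofReal_ne_top))
    rw [← lintegral_const_mul' _ _ ENNReal.ofReal_ne_top]
    refine setLIntegral_congr_fun measurableSet_Ioi fun t ht => ?_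
    have ht' : 0 < t := ht
    rw [← ofReal_norm, ← ENNReal.ofReal_pow (norm_nonneg _), ← ENNReal.ofReal_mul (by positivity),
      ← ENNReal.ofReal_mul (by positivity)]
    congr 1
    rw [norm_mul, norm_pow, Complex.norm_real, Real.norm_of_nonneg ht'.le, Complex.norm_exp,
      mul_pow, ← Real.exp_nat_mul]
    simp only [Complex.neg_re, Complex.ofReal_re, mul_one]
    rw [show ((2 : ℕ) : ℝ) * -t = -(2 * t) by push_cast; ring]
    field_simp
    ring
  refine ⟨hm.toLp _, ((ℓ + 1).factorial : ℝ), by positivity, fun z hz => ?_⟩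
  have hreal : ∀ x : ℝ, 0 < x → laplace (hm.toLp _) x =
      ((ℓ + 1).factorial : ℝ) / (1 + x : ℂ) ^ (ℓ + 2) := by
    intro x hx
    rw [laplace_congr_ae hm.coeFn_toLp]
    have key := Complex.integral_cpow_mul_exp_neg_mul_Ioi (a := ((ℓ + 1 : ℕ) : ℂ) + 1)
      (r := 1 + x) (by simp; positivity) (by positivity)
    rw [Complex.Gamma_nat_eq_factorial, add_sub_cancel_right] at key
    rw [laplace]
    refine Eq.trans (setIntegral_congr_fun measurableSet_Ioi fun t ht => ?_) (key.trans ?_)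
    · simp only [laplaceIntegrand]
      rw [Complex.cpow_natCast, mul_assoc, ← Complex.exp_add]
      congr 2
      push_cast
      ring
    · rw [show ((ℓ + 1 : ℕ) : ℂ) + 1 = ((ℓ + 2 : ℕ) : ℂ) by push_cast; ring, Complex.cpow_natCast]
      push_cast
      rw [one_div, inv_pow]
      ring
  have hf := (differentiableOn_laplace (hm.toLp _)).analyticOnNhd isOpen_rhp
  have hg : AnalyticOnNhd ℂ (fun z : ℂ => ((ℓ + 1).factorial : ℝ) / (1 + z) ^ (ℓ + 2)) rhp := by
    refine DifferentiableOn.analyticOnNhd (fun z hz => ?_) isOpen_rhp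
    have := pow_ne_zero (ℓ + 2) (one_add_ne_zero_of_mem_rhp hz)
    exact DifferentiableAt.differentiableWithinAt (by fun_prop (disch := assumption))
  refine hf.eqOn_of_preconnected_of_frequently_eq hg (convex_halfSpace_re_gt 0).isPreconnected
    (show (1 : ℂ) ∈ rhp by simp [rhp]) ?_ hz
  have ht : Filter.Tendsto (fun x : ℝ => (x : ℂ)) (nhdsWithin 1 (Ioi 1)) (nhdsWithin 1 {1}ᶜ) := by
    refine tendsto_nhdsWithin_of_tendsto_nhds_of_eventually_within _ ?_ ?_
    · exact (Complex.continuous_ofReal.tendsto' 1 1 (by simp)).mono_left nhdsWithin_le_nhds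
    · filter_upwards [self_mem_nhdsWithin] with x hx
      simpa using (ne_of_gt hx : x ≠ 1)
  refine ht.frequently (Filter.Eventually.frequently ?_)
  filter_upwards [self_mem_nhdsWithin] with x hx
  exact hreal x (one_pos.trans hx)

/-- An `h` orthogonal to the range is moved by an affine unitary `U` that carries its value at `z`
to the point `1`. As `U*` maps the kernel function back into the range, `U h` is orthogonal to the
kernel at `1`, hence `h` vanishes at `z`. -/
theorem exists_laplace_unitary (ℓ : ℕ) :
    ∃ L : LebesgueSpace ℓ ≃ₗᵢ[ℂ] BergmanSpace ℓ, ∀ h : LebesgueSpace ℓ, ∀ z ∈ rhp,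
      IntegrableOn (laplaceIntegrand h z) (Ioi 0) ∧ bval (L h) z = laplace h z := by
  obtain ⟨L, hL⟩ := exists_laplace_isometry ℓ
  suffices hsurj : Function.Surjective L from
    ⟨LinearIsometryEquiv.ofSurjective L hsurj, fun h z hz =>
      ⟨integrable_laplaceIntegrand h hz, hL h z hz⟩⟩
  obtain ⟨h₀, M, hM, hh₀⟩ := exists_laplace_kernel ℓ
  have : CompleteSpace (LinearMap.range L.toLinearMap) :=
    L.equivRange.toIsometryEquiv.completeSpace_iff.1 inferInstance
  suffices hbot : (LinearMap.range L.toLinearMap)ᗮ = ⊥ from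
    LinearMap.range_eq_top.1 ((Submodule.orthogonal_eq_bot_iff).1 hbot)
  rw [Submodule.eq_bot_iff]
  intro h hh
  refine bergman_ext fun z hz => ?_
  have hz' : 0 < z.re := hz
  rw [bval_zero]
  set b : ℂ := ((Real.sqrt (z.re ^ (ℓ + 2)) : ℝ) : ℂ)
  obtain ⟨U, hU, hU'⟩ := exists_affine_unitary (ℓ := ℓ) (b := b) z.im hz'
    (by rw [Complex.norm_real, Real.norm_of_nonneg (by positivity), Real.sq_sqrt (by positivity)])
  have hone : (1 : ℂ) ∈ rhp := by simp [rhp]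
  have key : bval (U h) 1 = 0 := by
    refine bval_one_eq_zero_of_inner_kernel hM (k := L h₀)
      (fun w hw => by rw [hL _ w hw, hh₀ w hw]) ?_
    rw [← U.symm.inner_map_map, U.symm_apply_apply]
    -- `U*` acts by `w ↦ w / Re z - i Im z / Re z`, so the dilation formula with these parameters
    -- exhibits `U* (L h₀)` as a Laplace transform.
    have hψ : ∀ t : ℝ, 0 < t → (fun t : ℝ => b⁻¹ / (z.re⁻¹ : ℝ) *
        Complex.exp (-(t * (Complex.I * (-(z.im / z.re) : ℝ)) / (z.re⁻¹ : ℝ)))) t = _ :=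
      fun t _ => rfl
    have hm := memLp_wcomp_dilation (inv_pos.2 hz') hψ h₀
    have e : U.symm (L h₀) = L (hm.toLp _) := bergman_ext fun w hw => by
      rw [hU' _ _ hw, hL _ _ (affine_inv_mem_rhp hz' hw), hL _ _ hw,
        laplace_congr_ae hm.coeFn_toLp, laplace_wcomp_dilation (inv_pos.2 hz') hψ]
      congr 2
      push_cast
      ring
    rw [e]
    exact (Submodule.mem_orthogonal _ _).1 hh _ ⟨_, rfl⟩
  have hb : b ≠ 0 := by
    exact Complex.ofReal_ne_zero.2 (Real.sqrt_ne_zero'.2 (pow_pos hz' _))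
  rw [hU _ _ hone, mul_one, mul_comm Complex.I, Complex.re_add_im] at key
  exact (mul_eq_zero.1 key).resolve_left hb

end Kernel

/-! ### Conjugations and everywhere defined operators. -/

section AbstractOperators

variable {E F : Type*} [NormedAddCommGroup E] [InnerProductSpace ℂ E]
  [NormedAddCommGroup F] [InnerProductSpace ℂ F]

theorem transportConj_apply (V : E ≃ₗᵢ[ℂ] F) (C : F →ₗ⋆[ℂ] F) (x : E) :
    transportConj V C x = V.symm (C (V x)) := rfl

theorem IsConjugation.transportConj {C : F →ₗ⋆[ℂ] F} (hC : IsConjugation C) (V : E ≃ₗᵢ[ℂ] F) :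
    IsConjugation (transportConj V C) := by
  refine ⟨fun x => ?_, fun x => ?_⟩
  · rw [transportConj_apply, LinearIsometryEquiv.norm_map, hC.1, LinearIsometryEquiv.norm_map]
  · rw [transportConj_apply, transportConj_apply, V.apply_symm_apply, hC.2, V.symm_apply_apply]

/-- The inner product identity exhibits `C A C` as the everywhere defined adjoint, and conjugating
once more by the involution `C` gives back `A`. -/
theorem isCSelfAdjoint_of_domain_eq_top [CompleteSpace E] {C : E →ₗ⋆[ℂ] E}
    (hC : IsConjugation C) {T : E →ₗ.[ℂ] E} (hT : T.domain = ⊤) {A : E → E}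
    (hA : ∀ x : T.domain, T x = A x) (h : ∀ x y, inner ℂ (A x) y = inner ℂ x (C (A (C y)))) :
    IsCSelfAdjoint C T := by
  have hdense : Dense (T.domain : Set E) := by
    rw [hT]
    exact dense_univ
  have hadj : ∀ y, ∀ x : T.domain, inner ℂ (C (A (C y))) (x : E) = inner ℂ y (T x) := by
    intro y x
    rw [hA, ← inner_conj_symm, ← h, inner_conj_symm]
  have hmem : ∀ y, y ∈ T.adjoint.domain := fun y =>
    LinearPMap.mem_adjoint_domain_of_exists y ⟨_, hadj y⟩
  refine ⟨hC, hdense, LinearPMap.ext ?_ ?_⟩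
  · rw [hT]
    exact (eq_top_iff.2 fun x _ => hmem (C x)).symm
  · intro x hx hx'
    change _ = C (T.adjoint ⟨C x, _⟩)
    rw [LinearPMap.adjoint_apply_eq hdense _ (hadj (C x)), hC.2, hC.2, hA]

end AbstractOperators

/-! ### Complex symmetry of the weighted composition on the Bergman space. -/

section ComplexSymmetry

variable {ℓ : ℕ}

/-- Inversion turns `z ↦ lam * z` into `z ↦ z / lam`, while the two prefactors leave `lam ^ (-(ℓ +
2)) = β⁻²`, which turns `β` into `β⁻¹`. -/
theorem inversion_dilation_inversion {lam : ℝ} (hlam : 0 < lam) {β : ℝ}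
    (hβ : β ^ 2 = lam ^ (ℓ + 2)) {D : BergmanSpace ℓ ≃ₗᵢ[ℂ] BergmanSpace ℓ}
    (hD : ∀ ξ : BergmanSpace ℓ, ∀ z ∈ rhp, bval (D ξ) z = β * bval ξ (lam * z))
    (hD' : ∀ ξ : BergmanSpace ℓ, ∀ z ∈ rhp, bval (D.symm ξ) z = (β : ℂ)⁻¹ * bval ξ (z / lam))
    {C : BergmanSpace ℓ →ₗ⋆[ℂ] BergmanSpace ℓ}
    (hC : ∀ ξ : BergmanSpace ℓ, ∀ z ∈ rhp,
      bval (C ξ) z = 1 / z ^ (ℓ + 2) * conj (bval ξ (1 / conj z))) (ξ : BergmanSpace ℓ) :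
    C (D (C ξ)) = D.symm ξ := by
  refine bergman_ext fun z hz => ?_
  have hz0 := ne_zero_of_mem_rhp hz
  have h1 : 1 / conj z ∈ rhp := by simpa using inv_mem_rhp (conj_mem_rhp hz)
  have h2 : lam * (1 / conj z) ∈ rhp := by simpa using affine_mem_rhp (c := 0) hlam h1
  have hl : (lam : ℂ) ≠ 0 := Complex.ofReal_ne_zero.2 hlam.ne'
  have hb : (β : ℂ) ≠ 0 := by
    refine Complex.ofReal_ne_zero.2 ?_
    rintro rfl
    rw [zero_pow two_ne_zero] at hβ
    exact (pow_pos hlam _).ne hβ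
  have hβ' : (β : ℂ) ^ 2 = (lam : ℂ) ^ (ℓ + 2) := by exact_mod_cast hβ
  rw [hC _ z hz, hD _ _ h1, hC _ _ h2, hD' _ z hz]
  have e : 1 / conj ((lam : ℂ) * (1 / conj z)) = z / lam := by
    simp
    field_simp
  rw [e]
  simp only [map_mul, Complex.conj_conj, map_div₀, map_one, map_pow, Complex.conj_ofReal]
  rw [mul_pow, ← hβ', div_pow, one_pow]
  field_simp

/-- The symbol of `B` fixes `-i c / s`, and the affine map of `U*` sends `0` to that point. So `U* B
U` is a scalar times a unitary dilation `D`, whose adjoint `D⁻¹` is `C D C`. -/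
theorem inner_weighted_composition {b : ℂ} (hb : b ≠ 0) {c s lam : ℝ} (hs : 0 < s)
    (hlam : 0 < lam) {θ : ℂ} {U : BergmanSpace ℓ ≃ₗᵢ[ℂ] BergmanSpace ℓ}
    (hU' : ∀ ξ : BergmanSpace ℓ, ∀ z ∈ rhp,
      bval (U.symm ξ) z = b⁻¹ * bval ξ ((z - Complex.I * c) / s))
    {C : BergmanSpace ℓ →ₗ⋆[ℂ] BergmanSpace ℓ}
    (hC : ∀ ξ : BergmanSpace ℓ, ∀ z ∈ rhp,
      bval (C ξ) z = 1 / z ^ (ℓ + 2) * conj (bval ξ (1 / conj z)))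
    {B : BergmanSpace ℓ → BergmanSpace ℓ}
    (hB : ∀ ξ : BergmanSpace ℓ, ∀ z ∈ rhp,
      bval (B ξ) z = θ * bval ξ (lam * z + Complex.I * (c * (lam - 1) / s : ℝ)))
    (ξ η : BergmanSpace ℓ) :
    inner ℂ (B ξ) η =
      inner ℂ ξ (transportConj U.symm C (B (transportConj U.symm C η))) := by
  set β : ℝ := Real.sqrt (lam ^ (ℓ + 2)) with hβdef
  have hβ : β ^ 2 = lam ^ (ℓ + 2) := Real.sq_sqrt (by positivity)
  have hβ0 : (β : ℂ) ≠ 0 :=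
    Complex.ofReal_ne_zero.2 (Real.sqrt_ne_zero'.2 (pow_pos hlam _))
  have hs0 : (s : ℂ) ≠ 0 := Complex.ofReal_ne_zero.2 hs.ne'
  obtain ⟨D, hD, hD'⟩ := exists_affine_unitary (ℓ := ℓ) (b := (β : ℂ)) 0 hlam (by
    rw [Complex.norm_real, Real.norm_eq_abs, sq_abs, hβ])
  simp only [Complex.ofReal_zero, mul_zero, add_zero, sub_zero] at hD hD'
  have hBD : ∀ ξ, U.symm (B ξ) = (θ / β) • D (U.symm ξ) := fun ξ => bergman_ext fun z hz => by
    have h2 : (lam : ℂ) * z ∈ rhp := by simpa using affine_mem_rhp (c := 0) hlam hz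
    rw [hU' _ z hz, hB _ _ (affine_inv_mem_rhp hs hz), bval_smul, hD _ z hz, hU' _ _ h2]
    have e : (lam : ℂ) * ((z - Complex.I * c) / s) + Complex.I * (c * (lam - 1) / s : ℝ) =
        (lam * z - Complex.I * c) / s := by
      push_cast
      field_simp
      ring
    rw [e]
    field_simp
  have hl : inner ℂ ((θ / β) • D (U.symm ξ)) (U.symm η) =
      conj (θ / β) * inner ℂ (D (U.symm ξ)) (U.symm η) :=
    inner_smul_left (𝕜 := ℂ) (E := BergmanSpace ℓ) (D (U.symm ξ)) (U.symm η) (θ / β)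
  have hr : inner ℂ (U.symm ξ) (conj (θ / β) • D.symm (U.symm η)) =
      conj (θ / β) * inner ℂ (U.symm ξ) (D.symm (U.symm η)) :=
    inner_smul_right (𝕜 := ℂ) (E := BergmanSpace ℓ) _ _ _
  rw [transportConj_apply, transportConj_apply, LinearIsometryEquiv.symm_symm,
    ← U.symm.inner_map_map (B ξ), hBD, hl, ← U.symm.inner_map_map ξ, U.symm_apply_apply, hBD,
    U.symm_apply_apply, LinearMap.map_smulₛₗ, inversion_dilation_inversion hlam hβ hD hD' hC, hr,
    ← D.inner_map_map _ (D.symm _), D.apply_symm_apply]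

end ComplexSymmetry

end BergmanLebesgue

/-! ### The main theorem. -/

theorem mainTheorem12 (ℓ : ℕ) (b : ℂ) (hb : b ≠ 0) (c : ℝ) (s : ℝ)
    (hs : s = ‖b‖ ^ (2 / ((ℓ : ℝ) + 2)))
    (lam : ℝ) (hlam : 0 < lam) (θ : ℂ)
    (f g : ℂ → ℂ) (hf : ∀ w ∈ rhp, f w = θ)
    (hg : ∀ w ∈ rhp, g w = lam * (w + Complex.I * c * (s : ℂ)⁻¹) - Complex.I * c * (s : ℂ)⁻¹)
    (ψ : ℝ → ℂ)
    (hψ : ∀ t : ℝ, 0 < t → ψ t =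
      θ / lam * Complex.exp (-(t * (Complex.I * c * (lam - 1) * (s : ℂ)⁻¹) / lam))) :
    -- `𝓛` is the Laplace transform, an isometric isomorphism onto the Bergman space
    ∃ 𝓛 : LebesgueSpace ℓ ≃ₗᵢ[ℂ] BergmanSpace ℓ,
      (∀ h : LebesgueSpace ℓ, ∀ z ∈ rhp,
        IntegrableOn (laplaceIntegrand h z) (Ioi 0) ∧ bval (𝓛 h) z = laplace h z) ∧
      -- `U` is the unitary operator `U_{b,c}`, so that `U* = U⁻¹`
      ∃ U : BergmanSpace ℓ ≃ₗᵢ[ℂ] BergmanSpace ℓ,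
        (∀ ξ : BergmanSpace ℓ, ∀ z ∈ rhp,
          bval (U ξ) z = b * bval ξ (s * z + Complex.I * c)) ∧
        -- `C` is the conjugation `C_⋆`
        ∃ C : BergmanSpace ℓ →ₗ⋆[ℂ] BergmanSpace ℓ,
          (∀ ξ : BergmanSpace ℓ, ∀ z ∈ rhp,
            bval (C ξ) z = 1 / z ^ (ℓ + 2) * conj (bval ξ (1 / conj z))) ∧
          IsConjugation C ∧
          -- `𝓛⁻¹ E_{f,g} 𝓛 = E_{ψ,φ}`
          (∀ h : LebesgueSpace ℓ, ∃ k : BergmanSpace ℓ,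
            EqOn (bval k) (wcomp f g (bval (𝓛 h))) rhp ∧
            𝓛.symm k =ᵐ[lebesgueMeasure ℓ] wcomp ψ (fun t => t / lam) h) ∧
          -- `W_{ψ,φ,max} = 𝓛⁻¹ W_{f,g,max} 𝓛`
          lebesgueWCompMax ℓ ψ (fun t => t / lam) (quasiMeasurePreserving_div ℓ hlam) =
            transportOp 𝓛 (bergmanWCompMax ℓ f g) ∧
          -- `W_{ψ,φ,max}` is `𝓛⁻¹ U C_⋆ U* 𝓛`-selfadjoint
          IsCSelfAdjoint (transportConj 𝓛 (transportConj U.symm C))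
            (lebesgueWCompMax ℓ ψ (fun t => t / lam) (quasiMeasurePreserving_div ℓ hlam)) := by
  have hb0 : 0 < ‖b‖ := norm_pos_iff.2 hb
  have hs0 : 0 < s := hs ▸ Real.rpow_pos_of_pos hb0 _
  have hbs : ‖b‖ ^ 2 = s ^ (ℓ + 2) := by
    rw [hs, ← Real.rpow_natCast (‖b‖ ^ (2 / ((ℓ : ℝ) + 2))), ← Real.rpow_mul hb0.le]
    push_cast
    rw [div_mul_cancel₀ _ (by positivity)]
    exact (Real.rpow_two _).symm
  -- The constants of `ψ` and `g` are collected into the single real shift `c * (lam - 1) / s`; its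
  -- reality is what makes the exponential unimodular.
  have hψ' : ∀ t : ℝ, 0 < t → ψ t = θ / lam *
      Complex.exp (-(t * (Complex.I * (c * (lam - 1) / s : ℝ)) / lam)) := by
    intro t ht
    rw [hψ t ht]
    congr 3
    push_cast
    ring
  have hg' : ∀ w ∈ rhp, g w = lam * w + Complex.I * (c * (lam - 1) / s : ℝ) := by
    intro w hw
    rw [hg w hw]
    push_cast
    ring
  obtain ⟨L, hL⟩ := exists_laplace_unitary ℓ
  obtain ⟨U, hU, hU'⟩ := exists_affine_unitary (ℓ := ℓ) c hs0 hbs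
  obtain ⟨C, hC, hCc⟩ := exists_inversion_conjugation ℓ
  have hm := fun h : LebesgueSpace ℓ => memLp_wcomp_dilation hlam hψ' h
  have hLA : ∀ h : LebesgueSpace ℓ, ∀ z ∈ rhp, bval (L ((hm h).toLp _)) z =
      θ * bval (L h) (lam * z + Complex.I * (c * (lam - 1) / s : ℝ)) := by
    intro h z hz
    rw [(hL _ z hz).2, (hL _ _ (affine_mem_rhp hlam hz)).2, laplace_congr_ae (hm h).coeFn_toLp,
      laplace_wcomp_dilation hlam hψ']
  have hE : ∀ h : LebesgueSpace ℓ,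
      EqOn (bval (L ((hm h).toLp _))) (wcomp f g (bval (L h))) rhp := by
    intro h z hz
    rw [hLA h z hz, wcomp, hf z hz, hg' z hz]
  refine ⟨L, hL, U, hU, C, hC, hCc, fun h => ⟨_, hE h, ?_⟩, ?_, ?_⟩
  · rw [L.symm_apply_apply]
    exact (hm h).coeFn_toLp
  · refine LinearPMap.ext ?_ ?_
    · refine (eq_top_iff.2 fun h _ => ?_).trans (eq_top_iff.2 fun h _ => ?_).symm
      · exact hm h
      · exact ⟨_, hE h⟩
    · intro h h1 h2
      change (hm h).toLp _ = L.symm (bergmanImage ⟨L h, h2⟩)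
      rw [LinearIsometryEquiv.eq_symm_apply]
      exact bergman_ext fun z hz => by rw [hE h hz, bergmanImage_eqOn _ hz]
  · refine isCSelfAdjoint_of_domain_eq_top ((hCc.transportConj _).transportConj _)
      (A := fun h => (hm h).toLp _) (eq_top_iff.2 fun h _ => hm h) (fun _ => rfl) fun x y => ?_
    -- The symmetry is proved for the operator carried to the Bergman space by `L`, then pulled back
    -- since `L` preserves inner products.
    have key := inner_weighted_composition (B := fun ξ => L ((hm (L.symm ξ)).toLp _)) hb hs0 hlam
      hU' hC (θ := θ) (fun ξ z hz => by rw [hLA _ z hz, L.apply_symm_apply]) (L x) (L y)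
    simp only [L.symm_apply_apply] at key
    rw [← L.inner_map_map, key, ← L.inner_map_map x, transportConj_apply L, L.apply_symm_apply]
    rfl
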